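/- Let $\alpha\in[1,2)$ and put $\nu_\alpha=\frac{\alpha-1}{2-\alpha}$, $\kappa_\alpha=\frac{2-\alpha}{2}$. Let $J_\nu(y)=\sum_{m\ge 0}\frac{(-1)^m}{m!\,\Gamma(m+\nu+1)}\left(\frac y2\right)^{2m+\nu}$ ($y\ge 0$) be the Bessel function of the first kind of order $\nu\ge 0$. Let $H^1_\alpha(-1,1)$ be the space of real $u\in L^2(-1,1)$ that are locally absolutely continuous in $(0,1]$ and in $[-1,0)$ and satisfy $\int_{-1}^1|x|^\alpha u'(x)^2\,dx<\infty$ and $u(-1)=0=u(1)$. Let $H^2_\alpha(-1,1)$ be the space of those $u\in H^1_\alpha(-1,1)$ for which $|x|^\alpha u'$ has a weak derivative on $(-1,1)$ that belongs to $L^2(-1,1)$. Consider the eigenvalue problem $$-(|x|^\alpha\Phi'(x))'=\lambda\,\Phi(x)\quad\text{in }(-1,1),\qquad \Phi(-1)=0=\Phi(1),\qquad \Phi\in H^2_\alpha(-1,1),$$ whose eigenspace for $\lambda\in\mathbb R$ is the set of all its solutions $\Phi$, regarded as a subspace of the real space $L^2(-1,1)$; $\lambda$ is an eigenvalue if this space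 is not $\{0\}$. The positive zeros of $J_{\nu_\alpha}$ form a strictly increasing infinite sequence $j_{\nu_\alpha,1}<j_{\nu_\alpha,2}<\cdots$, and the following hold. 1. The eigenvalues are exactly the numbers $\lambda_{\alpha,n}=\kappa_\alpha^2\,j_{\nu_\alpha,n}^2$, $n\ge 1$. 2. For every $n\ge1$ the eigenspace associated with $\lambda_{\alpha,n}$ has dimension $2$, and an orthonormal basis of it, in $L^2(-1,1)$, is formed by $$\tilde\Phi^{(r)}_{\alpha,n}(x)=\begin{cases}\dfrac{\sqrt{2\kappa_\alpha}}{|J'_{\nu_\alpha}(j_{\nu_\alpha,n})|}\,x^{(1-\alpha)/2}J_{\nu_\alpha}\!\left(j_{\nu_\alpha,n}x^{\kappa_\alpha}\right),&x\in(0,1),\\[2mm]0,&x\in(-1,0),\end{cases}$$ $$\tilde\Phi^{(l)}_{\alpha,n}(x)=\begin{cases}0,&x\in(0,1),\\[1mm]\dfrac{\sqrt{2\kappa_\alpha}}{|J'_{\nu_\alpha}(j_{\nu_\alpha,n})|}\,|x|^{(1-\alpha)/2}J_{\nu_\alpha}\!\left(j_{\nu_\alpha,n}|x|^{\kappa_\alpha}\right),&x\in(-1,0).\end{cases}$$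 3. The family $\{\tilde\Phi^{(r)}_{\alpha,n},\tilde\Phi^{(l)}_{\alpha,n}:n\ge1\}$ is an orthonormal basis of $L^2(-1,1)$. -/

import Mathlib

open MeasureTheory Set
open scoped ContDiff

noncomputable section

namespace StrongDegenerate

/-- The open interval `(-1,1)`. -/
abbrev Omega : Set ℝ := Ioo (-1) 1

/-- Lebesgue measure on `(-1,1)`. -/
abbrev vol : Measure ℝ := volume.restrict Omega

/-- The real Hilbert space `L²(-1,1)`. -/
abbrev X : Type := Lp ℝ 2 vol

/-- `g` is the weak (distributional) derivative of `F` on `(-1,1)`. -/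
def HasWeakDeriv (F g : ℝ → ℝ) : Prop :=
  LocallyIntegrableOn F Omega ∧ LocallyIntegrableOn g Omega ∧
    ∀ φ : ℝ → ℝ, ContDiff ℝ ∞ φ → HasCompactSupport φ → tsupport φ ⊆ Omega →
      ∫ x in Omega, F x * deriv φ x = -∫ x in Omega, g x * φ x

/-- The weighted space `H¹_α(-1,1)` for `1 ≤ α < 2`. Local absolute continuity on `(0,1]` and on
`[-1,0)` makes the pointwise derivative `deriv v` exist almost everywhere. -/
structure MemH1 (α : ℝ) (v : ℝ → ℝ) : Prop where
  memLp : MemLp v 2 vol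
  ac_right : ∀ ε ∈ Ioo (0 : ℝ) 1, AbsolutelyContinuousOnInterval v ε 1
  ac_left : ∀ ε ∈ Ioo (0 : ℝ) 1, AbsolutelyContinuousOnInterval v (-1) (-ε)
  energy : IntegrableOn (fun x => |x| ^ α * deriv v x ^ 2) Omega
  left_eq_zero : v (-1) = 0
  right_eq_zero : v 1 = 0

/-- The flux `|x|^α v'`. -/
def flux (α : ℝ) (v : ℝ → ℝ) (x : ℝ) : ℝ := |x| ^ α * deriv v x

/-- The weighted space `H²_α(-1,1)`, the domain of `v ↦ (|x|^α v')'`. -/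
def MemH2 (α : ℝ) (v : ℝ → ℝ) : Prop :=
  MemH1 α v ∧ ∃ g : ℝ → ℝ, MemLp g 2 vol ∧ HasWeakDeriv (flux α v) g

/-- `v` lies in `H²_α(-1,1)` and solves `-(|x|^α v')' = lam v` on `(-1,1)`, `v(-1) = 0 = v(1)`
(the boundary conditions are part of `MemH1`). -/
def Solves (α lam : ℝ) (v : ℝ → ℝ) : Prop :=
  MemH2 α v ∧ HasWeakDeriv (flux α v) (fun x => -(lam * v x))

/-! Linearity of the problem. -/

theorem HasWeakDeriv.congr {F G g h : ℝ → ℝ} (H : HasWeakDeriv F g)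
    (hF : F =ᵐ[vol] G) (hg : g =ᵐ[vol] h) : HasWeakDeriv G h := by
  obtain ⟨h1, h2, h3⟩ := H
  refine ⟨h1.congr hF, h2.congr hg, fun φ a b c => ?_⟩
  have e1 : ∫ x in Omega, G x * deriv φ x = ∫ x in Omega, F x * deriv φ x :=
    integral_congr_ae (by filter_upwards [hF] with x hx; rw [hx])
  have e2 : ∫ x in Omega, h x * φ x = ∫ x in Omega, g x * φ x :=
    integral_congr_ae (by filter_upwards [hg] with x hx; rw [hx])
  rw [e1, e2, h3 φ a b c]

theorem integrable_mul_test {F ψ : ℝ → ℝ} (hF : LocallyIntegrableOn F Omega)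
    (hψ : Continuous ψ) (hc : HasCompactSupport ψ) (hs : tsupport ψ ⊆ Omega) :
    IntegrableOn (fun x => F x * ψ x) Omega := by
  have h1 : IntegrableOn F (tsupport ψ) := hF.integrableOn_compact_subset hs hc
  have h2 : IntegrableOn (fun x => F x * ψ x) (tsupport ψ) :=
    h1.mul_continuousOn hψ.continuousOn hc
  refine (h2.integrable_of_forall_notMem_eq_zero fun x hx => ?_).integrableOn
  simp [image_eq_zero_of_notMem_tsupport hx]

theorem HasWeakDeriv.add {F G g h : ℝ → ℝ} (H : HasWeakDeriv F g) (K : HasWeakDeriv G h) :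
    HasWeakDeriv (F + G) (g + h) := by
  obtain ⟨h1, h2, h3⟩ := H
  obtain ⟨k1, k2, k3⟩ := K
  refine ⟨h1.add k1, h2.add k2, fun φ a b c => ?_⟩
  have d1 : Continuous (deriv φ) := a.continuous_deriv (by simp)
  have d2 : HasCompactSupport (deriv φ) := b.deriv
  have d3 : tsupport (deriv φ) ⊆ Omega :=
    (closure_minimal support_deriv_subset (isClosed_tsupport φ)).trans c
  simp only [Pi.add_apply, add_mul]
  rw [integral_add (integrable_mul_test h1 d1 d2 d3) (integrable_mul_test k1 d1 d2 d3),
    integral_add (integrable_mul_test h2 a.continuous b c)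
      (integrable_mul_test k2 a.continuous b c), h3 φ a b c, k3 φ a b c]
  ring

theorem HasWeakDeriv.smul {F g : ℝ → ℝ} (c : ℝ) (H : HasWeakDeriv F g) :
    HasWeakDeriv (c • F) (c • g) := by
  obtain ⟨h1, h2, h3⟩ := H
  refine ⟨h1.smul c, h2.smul c, fun φ a b d => ?_⟩
  simp only [Pi.smul_apply, smul_eq_mul, mul_assoc]
  rw [integral_const_mul, integral_const_mul, h3 φ a b d]
  ring

theorem MemH1.ae_differentiableAt {α : ℝ} {v : ℝ → ℝ} (hv : MemH1 α v) :
    ∀ᵐ x ∂vol, DifferentiableAt ℝ v x := by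
  have hr : ∀ᵐ x : ℝ, ∀ n : ℕ, x ∈ uIcc (1 / ((n : ℝ) + 2)) 1 → DifferentiableAt ℝ v x := by
    rw [ae_all_iff]
    intro n
    refine (hv.ac_right _ ⟨by positivity, ?_⟩).ae_differentiableAt
    rw [div_lt_one (by positivity)]
    linarith [(Nat.cast_nonneg n : (0 : ℝ) ≤ n)]
  have hl : ∀ᵐ x : ℝ, ∀ n : ℕ, x ∈ uIcc (-1) (-(1 / ((n : ℝ) + 2))) →
      DifferentiableAt ℝ v x := by
    rw [ae_all_iff]
    intro n
    refine (hv.ac_left _ ⟨by positivity, ?_⟩).ae_differentiableAt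
    rw [div_lt_one (by positivity)]
    linarith [(Nat.cast_nonneg n : (0 : ℝ) ≤ n)]
  have h0 : ∀ᵐ x : ℝ, x ≠ 0 := by simp [ae_iff]
  have hm : ∀ᵐ x ∂vol, x ∈ Omega := ae_restrict_mem measurableSet_Ioo
  filter_upwards [ae_restrict_of_ae hr, ae_restrict_of_ae hl, ae_restrict_of_ae h0, hm]
    with x xr xl x0 xm
  obtain ⟨n, hn⟩ := exists_nat_one_div_lt (abs_pos.2 x0)
  have hle : 1 / ((n : ℝ) + 2) ≤ |x| := by
    refine le_trans ?_ hn.le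
    gcongr
    norm_num
  rcases lt_or_gt_of_ne x0 with h | h
  · rw [abs_of_neg h] at hle
    exact xl n (by rw [mem_uIcc]; left; constructor <;> linarith [xm.1])
  · rw [abs_of_pos h] at hle
    exact xr n (by rw [mem_uIcc]; left; constructor <;> linarith [xm.2])

theorem flux_add {α : ℝ} {v w : ℝ → ℝ} (hv : MemH1 α v) (hw : MemH1 α w) :
    flux α v + flux α w =ᵐ[vol] flux α (v + w) := by
  filter_upwards [hv.ae_differentiableAt, hw.ae_differentiableAt] with x hx hy
  simp [flux, deriv_add hx hy, mul_add]

theorem flux_smul {α : ℝ} (c : ℝ) (v : ℝ → ℝ) : c • flux α v = flux α (c • v) := by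
  ext x
  simp only [flux, Pi.smul_apply, smul_eq_mul, deriv_const_smul_field]
  ring

theorem MemH1.add {α : ℝ} {v w : ℝ → ℝ} (hv : MemH1 α v) (hw : MemH1 α w) :
    MemH1 α (v + w) where
  memLp := hv.memLp.add hw.memLp
  ac_right ε hε := (hv.ac_right ε hε).add (hw.ac_right ε hε)
  ac_left ε hε := (hv.ac_left ε hε).add (hw.ac_left ε hε)
  energy := by
    refine Integrable.mono' ((hv.energy.add hw.energy).const_mul 2) ?_ ?_
    · have : Measurable fun x : ℝ => |x| ^ α := by fun_prop
      exact (this.mul ((measurable_deriv (v + w)).pow_const 2)).aestronglyMeasurable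
    · filter_upwards [hv.ae_differentiableAt, hw.ae_differentiableAt] with x hx hy
      have hp : 0 ≤ |x| ^ α := Real.rpow_nonneg (abs_nonneg x) α
      rw [deriv_add hx hy, Real.norm_of_nonneg (by positivity)]
      simp only [Pi.add_apply]
      nlinarith [mul_nonneg hp (sq_nonneg (deriv v x - deriv w x))]
  left_eq_zero := by simp [hv.left_eq_zero, hw.left_eq_zero]
  right_eq_zero := by simp [hv.right_eq_zero, hw.right_eq_zero]

theorem MemH1.smul {α : ℝ} {v : ℝ → ℝ} (c : ℝ) (hv : MemH1 α v) : MemH1 α (c • v) where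
  memLp := hv.memLp.const_smul c
  ac_right ε hε := (hv.ac_right ε hε).const_smul c
  ac_left ε hε := (hv.ac_left ε hε).const_smul c
  energy := by
    refine (hv.energy.const_mul (c ^ 2)).congr (.of_forall fun x => ?_)
    simp only [deriv_const_smul_field, smul_eq_mul]
    ring
  left_eq_zero := by simp [hv.left_eq_zero]
  right_eq_zero := by simp [hv.right_eq_zero]

theorem MemH1.zero (α : ℝ) : MemH1 α 0 where
  memLp := MemLp.zero
  ac_right ε _ := 
    (LipschitzWith.const (0 : ℝ)).lipschitzOnWith.absolutelyContinuousOnInterval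
  ac_left ε _ := 
    (LipschitzWith.const (0 : ℝ)).lipschitzOnWith.absolutelyContinuousOnInterval
  energy := by simp
  left_eq_zero := rfl
  right_eq_zero := rfl

theorem Solves.add {α lam : ℝ} {v w : ℝ → ℝ} (hv : Solves α lam v) (hw : Solves α lam w) :
    Solves α lam (v + w) := by
  obtain ⟨⟨hv1, g, hg, hvg⟩, hv2⟩ := hv
  obtain ⟨⟨hw1, h, hh, hwh⟩, hw2⟩ := hw
  refine ⟨⟨hv1.add hw1, g + h, hg.add hh,
    (hvg.add hwh).congr (flux_add hv1 hw1) .rfl⟩, ?_⟩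
  refine (hv2.add hw2).congr (flux_add hv1 hw1) (.of_forall fun x => ?_)
  simp only [Pi.add_apply]
  ring

theorem Solves.smul {α lam : ℝ} {v : ℝ → ℝ} (c : ℝ) (hv : Solves α lam v) :
    Solves α lam (c • v) := by
  obtain ⟨⟨hv1, g, hg, hvg⟩, hv2⟩ := hv
  refine ⟨⟨hv1.smul c, c • g, hg.const_smul c, flux_smul (α := α) c v ▸ hvg.smul c⟩, ?_⟩
  refine (hv2.smul c).congr (by rw [flux_smul]) (.of_forall fun x => ?_)
  simp only [Pi.smul_apply, smul_eq_mul]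
  ring

theorem Solves.zero (α lam : ℝ) : Solves α lam 0 := by
  have h : HasWeakDeriv (flux α 0) 0 := by
    have e : flux α 0 = 0 := by ext x; simp [flux]
    rw [e]
    exact ⟨locallyIntegrableOn_zero, locallyIntegrableOn_zero, fun φ _ _ _ => by simp⟩
  exact ⟨⟨MemH1.zero α, 0, MemLp.zero, h⟩, h.congr .rfl (.of_forall fun x => by simp)⟩

/-- The eigenspace of `-(|x|^α u')' = lam u`, `u(±1) = 0`, as a subspace of `L²(-1,1)`: the classes
having a representative in `H²_α(-1,1)` that solves the problem. -/
def eigenspace (α lam : ℝ) : Submodule ℝ X where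
  carrier := {u | ∃ v : ℝ → ℝ, u =ᵐ[vol] v ∧ Solves α lam v}
  zero_mem' := ⟨0, Lp.coeFn_zero ℝ 2 vol, Solves.zero α lam⟩
  add_mem' := by
    rintro u w ⟨v, hv, hs⟩ ⟨v', hv', hs'⟩
    exact ⟨v + v', (Lp.coeFn_add u w).trans (hv.add hv'), hs.add hs'⟩
  smul_mem' := by
    rintro c u ⟨v, hv, hs⟩
    exact ⟨c • v, (Lp.coeFn_smul c u).trans (hv.const_smul c), hs.smul c⟩

/-- `lam` is an eigenvalue: the problem has a solution that is not (a.e.) zero. -/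
def IsEigenvalue (α lam : ℝ) : Prop := ∃ u ∈ eigenspace α lam, u ≠ 0

/-- The Bessel function of the first kind of real order `ν`, for real `y ≥ 0`. -/
def besselJ (ν y : ℝ) : ℝ :=
  ∑' m : ℕ, (-1) ^ m / (m.factorial * Real.Gamma (m + ν + 1)) * (y / 2) ^ (2 * (m : ℝ) + ν)

/-- For `n ≥ 1`, the `n`-th positive zero of `besselJ ν`, each being the least zero above the
previous one; the recursion starts from the value `0` at index `0`. -/
def besselJZero (ν : ℝ) : ℕ → ℝ
  | 0 => 0
  | n + 1 => sInf {y : ℝ | besselJZero ν n < y ∧ besselJ ν y = 0}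

/-- `ν_α = (α - 1) / (2 - α)`. -/
def nu (α : ℝ) : ℝ := (α - 1) / (2 - α)

/-- `κ_α = (2 - α) / 2`. -/
def kappa (α : ℝ) : ℝ := (2 - α) / 2

/-- `j_{ν_α,n}`. -/
def jz (α : ℝ) (n : ℕ) : ℝ := besselJZero (nu α) n

/-- `λ_{α,n} = κ_α² j_{ν_α,n}²`. -/
def eigval (α : ℝ) (n : ℕ) : ℝ := kappa α ^ 2 * jz α n ^ 2

/-- The normalized profile, a function of `t = |x|`. -/
def profile (α : ℝ) (n : ℕ) (t : ℝ) : ℝ :=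
  Real.sqrt (2 * kappa α) / |deriv (besselJ (nu α)) (jz α n)| *
    (t ^ ((1 - α) / 2) * besselJ (nu α) (jz α n * t ^ kappa α))

/-- The eigenfunction supported in `(0,1)`. -/
def phiRight (α : ℝ) (n : ℕ) (x : ℝ) : ℝ := if 0 < x then profile α n |x| else 0

/-- The eigenfunction supported in `(-1,0)`. -/
def phiLeft (α : ℝ) (n : ℕ) (x : ℝ) : ℝ := if x < 0 then profile α n |x| else 0

end StrongDegenerate

end

open StrongDegenerate

/-!
# The spectrum of a strongly degenerate operator

On each side of `0` the equation `-(|x|^α u')' = lam u` has, up to multiples, one solution that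
stays bounded at `0`. With `β = lam / (2-α)²` it is `radial α β x = besselSeries ν (β |x|^(2-α))`,
where `J_ν(y) = (y/2)^ν besselSeries ν (y²/4)`; the termwise derivative and the three-term
recurrence of the series (`hasDerivAt_besselSeries`, `besselSeries_recurrence`) give the equation
for all real `lam`, without division by `lam` and without a singularity in the formulas.

A solution in the energy space has vanishing flux at `0`: by the lemma of du Bois-Reymond the flux
is a constant plus a primitive of `-lam u`, and since `1 ≤ α` a nonzero constant would make the
energy infinite (`Solves.flux_eq`). The problem thus becomes an integral equation on each half
(`IntegralSolution`), and the two halves decouple. The Wronskian of an integral solution and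
`radial α β` is constant and tends to `0` at `0`, so that it vanishes at the regular endpoint `1`,
where both are determined by their Cauchy data: either the solution is zero, or `radial α β`
vanishes at `1` and the solution is a multiple of it (`half_interval_solution`). Conversely the
functions `twoSided α β a b` solve the problem when `besselSeries ν β = 0` (`solves_twoSided`).
Hence the eigenvalues are `β (2-α)²` for the zeros `β = j²/4` of the series, with two-dimensional
eigenspaces. The normalization is Rellich's identity (`integral_radial_sq`), and orthogonality
comes from the Wronskian (`integral_radial_mul_radial`).

For completeness, the inverse of the operator is written as `V* V` with `V` a weighted Volterra
operator whose kernel is square integrable; Hilbert–Schmidt operators are compact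
(`isCompactOperator_compLpL₂_flip`). An eigenfunction of `V* V` is an integral solution
(`exists_integralSolution`), hence a combination of the functions above, and the spectral theorem
shows that these have trivial orthogonal complement (`eigenSpan_orthogonal`). As `L²(-1,1)` has
infinite dimension, the series has infinitely many zeros; they are simple, hence locally finite,
and the recursion defining `besselJZero` runs through all of them.
-/

namespace StrongDegenerate

noncomputable section

/-! ### The series of the Bessel function -/

/-- The entire function `z ↦ ∑ (-z)^m / (m! Γ(m+ν+1))`, for which
`J_ν(y) = (y/2)^ν besselSeries ν (y²/4)`. -/
def besselSeries (ν z : ℝ) : ℝ :=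
  ∑' m : ℕ, (-z) ^ m / (m.factorial * Real.Gamma (m + ν + 1))

theorem Gamma_le_Gamma_add_nat {ν : ℝ} (hν : 0 ≤ ν) (m : ℕ) :
    Real.Gamma (ν + 1) ≤ Real.Gamma (m + ν + 1) := by
  induction m with
  | zero => simp
  | succ m ih =>
    have h : (0 : ℝ) ≤ m := m.cast_nonneg
    have e : ((m + 1 : ℕ) : ℝ) + ν + 1 = (m + ν + 1) + 1 := by push_cast; ring
    rw [e, Real.Gamma_add_one (s := m + ν + 1) (by positivity)]
    have : 0 < Real.Gamma (m + ν + 1) := Real.Gamma_pos_of_pos (by positivity)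
    nlinarith

theorem Gamma_nat_add_pos {ν : ℝ} (hν : 0 ≤ ν) (m : ℕ) : 0 < Real.Gamma (m + ν + 1) :=
  Real.Gamma_pos_of_pos (by positivity)

theorem norm_besselSeries_term_le {ν : ℝ} (hν : 0 ≤ ν) {z R : ℝ} (hz : |z| ≤ R) (m : ℕ) :
    ‖(-z) ^ m / (m.factorial * Real.Gamma (m + ν + 1))‖ ≤
      R ^ m / m.factorial / Real.Gamma (ν + 1) := by
  have h0 : 0 < Real.Gamma (ν + 1) := Real.Gamma_pos_of_pos (by positivity)
  have h1 := Gamma_le_Gamma_add_nat hν m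
  have h2 := Gamma_nat_add_pos hν m
  have h3 : 0 ≤ R := (abs_nonneg z).trans hz
  rw [norm_div, norm_pow, norm_neg, Real.norm_eq_abs, Real.norm_of_nonneg (by positivity),
    div_div]
  gcongr

theorem summable_besselSeries {ν : ℝ} (hν : 0 ≤ ν) (z : ℝ) :
    Summable fun m : ℕ => (-z) ^ m / (m.factorial * Real.Gamma (m + ν + 1)) :=
  .of_norm_bounded ((Real.summable_pow_div_factorial |z|).div_const _)
    (norm_besselSeries_term_le hν le_rfl)

theorem besselSeries_term_deriv {ν : ℝ} (z : ℝ) (m : ℕ) :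
    ((m + 1 : ℕ) : ℝ) * (-z) ^ m / ((m + 1).factorial * Real.Gamma ((m + 1 : ℕ) + ν + 1)) =
      (-z) ^ m / (m.factorial * Real.Gamma (m + (ν + 1) + 1)) := by
  have e : ((m + 1 : ℕ) : ℝ) + ν + 1 = m + (ν + 1) + 1 := by push_cast; ring
  have h : ((m + 1 : ℕ) : ℝ) ≠ 0 := by positivity
  rw [e, Nat.factorial_succ, Nat.cast_mul, mul_assoc, mul_div_mul_left _ _ h]

theorem hasDerivAt_besselSeries {ν : ℝ} (hν : 0 ≤ ν) (z : ℝ) :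
    HasDerivAt (besselSeries ν) (-besselSeries (ν + 1) z) z := by
  set g' : ℕ → ℝ → ℝ := fun m y =>
    -((m : ℝ) * (-y) ^ (m - 1) / (m.factorial * Real.Gamma (m + ν + 1))) with hg'
  set R := |z| + 1
  set u : ℕ → ℝ := fun m => m.casesOn 0 fun k =>
    R ^ k / k.factorial / Real.Gamma (ν + 1 + 1)
  have hu : Summable u := by
    rw [← summable_nat_add_iff 1]
    exact (Real.summable_pow_div_factorial R).div_const _
  have key : HasDerivAt (fun y => ∑' m : ℕ, (-y) ^ m / (m.factorial * Real.Gamma (m + ν + 1)))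
      (∑' m, g' m z) z := by
    refine hasDerivAt_tsum_of_isPreconnected (t := Metric.ball 0 R) (y₀ := z) hu
      Metric.isOpen_ball (convex_ball _ _).isPreconnected ?_ ?_ ?_ (summable_besselSeries hν z) ?_
    · intro m y _
      have h := (((hasDerivAt_id y).neg.pow m).div_const (m.factorial * Real.Gamma (m + ν + 1)))
      refine h.congr_deriv ?_
      simp only [hg', id, Pi.neg_apply]
      ring
    · intro m y hy
      have hy : |y| ≤ R := by simpa using (mem_ball_zero_iff.1 hy).le
      cases m with
      | zero => simp [hg', u]
      | succ k =>
        simp only [hg', u, Nat.add_sub_cancel, norm_neg]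
        rw [besselSeries_term_deriv]
        exact norm_besselSeries_term_le (by positivity) hy k
    · simp [R]
    · simp [R]
  refine key.congr_deriv ?_
  have hs : Summable fun m => g' m z := by
    refine .of_norm_bounded hu fun m => ?_
    cases m with
    | zero => simp [hg', u]
    | succ k =>
      simp only [hg', u, Nat.add_sub_cancel, norm_neg]
      rw [besselSeries_term_deriv]
      exact norm_besselSeries_term_le (by positivity) (by simp [R]) k
  rw [hs.tsum_eq_zero_add, besselSeries, ← tsum_neg]
  simp only [hg', Nat.add_sub_cancel, besselSeries_term_deriv]
  simp

theorem continuous_besselSeries {ν : ℝ} (hν : 0 ≤ ν) : Continuous (besselSeries ν) :=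
  continuous_iff_continuousAt.2 fun z => (hasDerivAt_besselSeries hν z).continuousAt

/-- The three-term recurrence, which turns into Bessel's differential equation. -/
theorem besselSeries_recurrence {ν : ℝ} (hν : 0 ≤ ν) (z : ℝ) :
    besselSeries ν z = (ν + 1) * besselSeries (ν + 1) z - z * besselSeries (ν + 2) z := by
  have h1 := summable_besselSeries (ν := ν + 1) (by positivity) z
  have h2 := summable_besselSeries (ν := ν + 2) (by positivity) z
  -- the terms `m (-z)^m / (m! Γ(m+ν+2))`, whose sum is `-z` times the series of order `ν + 2`
  set q : ℕ → ℝ := fun m => (m : ℝ) * (-z) ^ m / (m.factorial * Real.Gamma (m + ν + 2)) with hq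
  have e (k : ℕ) : q (k + 1) =
      -z * ((-z) ^ k / (k.factorial * Real.Gamma (k + (ν + 2) + 1))) := by
    have := besselSeries_term_deriv (ν := ν + 1) z k
    rw [show (k : ℝ) + (ν + 2) + 1 = k + (ν + 1 + 1) + 1 by ring, ← this, hq]
    simp only [pow_succ]
    rw [show ((k + 1 : ℕ) : ℝ) + ν + 2 = (k + 1 : ℕ) + (ν + 1) + 1 by ring]
    ring
  have hs : Summable q := by
    rw [← summable_nat_add_iff 1]
    simpa only [e] using h2.mul_left (-z)
  have hsum : ∑' m, q m = -z * besselSeries (ν + 2) z := by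
    rw [hs.tsum_eq_zero_add]
    simp only [e, tsum_mul_left]
    simp [hq, besselSeries]
  have : besselSeries ν z = ∑' m : ℕ,
      ((ν + 1) * ((-z) ^ m / (m.factorial * Real.Gamma (m + (ν + 1) + 1))) + q m) := by
    refine tsum_congr fun m => ?_
    have h3 := (Gamma_nat_add_pos hν m).ne'
    have h4 : (m : ℝ) + ν + 1 ≠ 0 := by positivity
    have h5 : (m.factorial : ℝ) ≠ 0 := by positivity
    simp only [hq]
    rw [show (m : ℝ) + (ν + 1) + 1 = (m + ν + 1) + 1 by ring,
      show (m : ℝ) + ν + 2 = (m + ν + 1) + 1 by ring, Real.Gamma_add_one h4]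
    field_simp
    ring
  rw [this, (h1.mul_left _).tsum_add hs, hsum, tsum_mul_left, besselSeries, besselSeries]
  ring

theorem besselSeries_pos_of_nonpos {ν z : ℝ} (hν : 0 ≤ ν) (hz : z ≤ 0) :
    0 < besselSeries ν z := by
  have hz' : 0 ≤ -z := by linarith
  refine (summable_besselSeries hν z).tsum_pos (fun m => ?_) 0 ?_
  · have := Gamma_nat_add_pos hν m
    positivity
  · have := Gamma_nat_add_pos hν 0
    simp only [pow_zero]
    positivity

theorem besselJ_eq {ν y : ℝ} (hy : 0 < y) :
    besselJ ν y = (y / 2) ^ ν * besselSeries ν (y ^ 2 / 4) := by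
  rw [besselJ, besselSeries, ← tsum_mul_left]
  refine tsum_congr fun m => ?_
  have h : (0 : ℝ) < y / 2 := by positivity
  rw [Real.rpow_add h, show (2 : ℝ) * (m : ℝ) = ((2 * m : ℕ) : ℝ) by push_cast; ring,
    Real.rpow_natCast, pow_mul, show (y / 2) ^ 2 = y ^ 2 / 4 by ring, neg_pow (y ^ 2 / 4)]
  ring

theorem besselJ_eq_zero_iff {ν y : ℝ} (hy : 0 < y) :
    besselJ ν y = 0 ↔ besselSeries ν (y ^ 2 / 4) = 0 := by
  have h : (y / 2) ^ ν ≠ 0 := (Real.rpow_pos_of_pos (by positivity) ν).ne'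
  simp [besselJ_eq hy, h]

/-- At a positive zero of `J_ν` the derivative only sees the derivative of the series. -/
theorem deriv_besselJ_of_zero {ν y : ℝ} (hν : 0 ≤ ν) (hy : 0 < y)
    (h0 : besselSeries ν (y ^ 2 / 4) = 0) :
    deriv (besselJ ν) y = -((y / 2) ^ ν * (y / 2) * besselSeries (ν + 1) (y ^ 2 / 4)) := by
  have e : besselJ ν =ᶠ[nhds y] fun t => (t / 2) ^ ν * besselSeries ν (t ^ 2 / 4) := by
    filter_upwards [lt_mem_nhds hy] with t ht using besselJ_eq ht
  rw [e.deriv_eq]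
  have d1 : HasDerivAt (fun t : ℝ => t ^ 2 / 4) (y / 2) y := by
    refine (((hasDerivAt_id y).pow 2).div_const 4).congr_deriv ?_
    simp; ring
  have d2 := (hasDerivAt_besselSeries hν (y ^ 2 / 4)).comp y d1
  have d3 : HasDerivAt (fun t : ℝ => (t / 2) ^ ν) _ y :=
    ((hasDerivAt_id y).div_const 2).rpow_const (p := ν) (.inl (by simp; positivity))
  have d4 := d3.mul d2
  refine d4.deriv.trans ?_
  simp only [Function.comp, h0]
  ring

/-! ### Radial solutions -/

theorem nu_nonneg {α : ℝ} (hα1 : 1 ≤ α) (hα2 : α < 2) : 0 ≤ nu α :=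
  div_nonneg (by linarith) (by linarith)

theorem nu_add_one_mul {α : ℝ} (hα2 : α < 2) : (nu α + 1) * (2 - α) = 1 := by
  have : 2 - α ≠ 0 := by linarith
  rw [nu]
  field_simp
  ring

/-- The even solution of `-(|x|^α u')' = β (2-α)² u` on `ℝ ∖ {0}` that stays bounded at `0`. -/
def radial (α β x : ℝ) : ℝ := besselSeries (nu α) (β * |x| ^ (2 - α))

/-- The flux `|x|^α u'` of `u = radial α β`. -/
def radialFlux (α β x : ℝ) : ℝ :=
  -(β * (2 - α)) * x * besselSeries (nu α + 1) (β * |x| ^ (2 - α))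

theorem hasDerivAt_abs_rpow_of_ne_zero {x : ℝ} (hx : x ≠ 0) (r : ℝ) :
    HasDerivAt (fun y : ℝ => |y| ^ r) (r * |x| ^ (r - 2) * x) x := by
  have h := (hasDerivAt_abs hx).rpow_const (p := r) (.inl (abs_ne_zero.2 hx))
  refine h.congr_deriv ?_
  have e : |x| ^ (r - 1) = |x| ^ (r - 2) * |x| := by
    rw [← Real.rpow_add_one (abs_ne_zero.2 hx)]
    ring_nf
  have e2 : (SignType.sign x : ℝ) * |x| = x := sign_mul_abs x
  rw [e]
  calc _ = r * |x| ^ (r - 2) * ((SignType.sign x : ℝ) * |x|) := by ring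
    _ = _ := by rw [e2]

theorem hasDerivAt_radial {α β x : ℝ} (hα1 : 1 ≤ α) (hα2 : α < 2) (hx : x ≠ 0) :
    HasDerivAt (radial α β) (|x| ^ (-α) * radialFlux α β x) x := by
  have h1 := (hasDerivAt_abs_rpow_of_ne_zero hx (2 - α)).const_mul β
  have h2 := (hasDerivAt_besselSeries (nu_nonneg hα1 hα2) (β * |x| ^ (2 - α))).comp x h1
  refine h2.congr_deriv ?_
  rw [radialFlux, show 2 - α - 2 = -α by ring]
  ring

/-- Bessel's equation in divergence form. -/
theorem hasDerivAt_radialFlux {α β x : ℝ} (hα1 : 1 ≤ α) (hα2 : α < 2) (hx : x ≠ 0) :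
    HasDerivAt (radialFlux α β) (-(β * (2 - α) ^ 2 * radial α β x)) x := by
  have hν := nu_nonneg hα1 hα2
  have h1 := (hasDerivAt_abs_rpow_of_ne_zero hx (2 - α)).const_mul β
  have h2 := (hasDerivAt_besselSeries (ν := nu α + 1) (by linarith) (β * |x| ^ (2 - α))).comp x h1
  have h3 := ((hasDerivAt_id x).const_mul (-(β * (2 - α)))).mul h2
  refine h3.congr_deriv ?_
  have e : |x| ^ (2 - α) = |x| ^ (2 - α - 2) * (x * x) := by
    rw [← abs_mul_abs_self x, ← mul_assoc, ← Real.rpow_add_one (abs_ne_zero.2 hx),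
      ← Real.rpow_add_one (abs_ne_zero.2 hx)]
    ring_nf
  have hr := besselSeries_recurrence hν (β * |x| ^ (2 - α))
  have h4 := nu_add_one_mul hα2
  rw [radial, hr]
  simp only [Function.comp, id, show nu α + 1 + 1 = nu α + 2 by ring]
  generalize besselSeries (nu α + 1) (β * |x| ^ (2 - α)) = a
  generalize besselSeries (nu α + 2) (β * |x| ^ (2 - α)) = b
  rw [e]
  generalize |x| ^ (2 - α - 2) = c
  linear_combination (β * (2 - α) * a) * h4

theorem continuous_abs_rpow {r : ℝ} (hr : 0 ≤ r) : Continuous fun x : ℝ => |x| ^ r :=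
  continuous_abs.rpow_const fun _ => .inr hr

theorem continuous_radial {α : ℝ} (hα1 : 1 ≤ α) (hα2 : α < 2) (β : ℝ) :
    Continuous (radial α β) :=
  (continuous_besselSeries (nu_nonneg hα1 hα2)).comp
    ((continuous_abs_rpow (by linarith)).const_mul β)

theorem continuous_radialFlux {α : ℝ} (hα1 : 1 ≤ α) (hα2 : α < 2) (β : ℝ) :
    Continuous (radialFlux α β) :=
  (continuous_id.const_mul _).mul
    ((continuous_besselSeries (by linarith [nu_nonneg hα1 hα2])).comp
      ((continuous_abs_rpow (by linarith)).const_mul β))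

theorem radial_one (α β : ℝ) : radial α β 1 = besselSeries (nu α) β := by simp [radial]

theorem radialFlux_one (α β : ℝ) :
    radialFlux α β 1 = -(β * (2 - α)) * besselSeries (nu α + 1) β := by simp [radialFlux]

theorem radialFlux_zero (α β : ℝ) : radialFlux α β 0 = 0 := by simp [radialFlux]

theorem radial_neg (α β x : ℝ) : radial α β (-x) = radial α β x := by simp [radial]

theorem radial_abs (α β x : ℝ) : radial α β |x| = radial α β x := by simp [radial]

/-- The Wronskian of two radial solutions vanishing at `1` gives their orthogonality. -/
theorem integral_radial_mul_radial {α β γ : ℝ} (hα1 : 1 ≤ α) (hα2 : α < 2) (hβγ : β ≠ γ)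
    (hβ : besselSeries (nu α) β = 0) (hγ : besselSeries (nu α) γ = 0) :
    ∫ x in (0 : ℝ)..1, radial α β x * radial α γ x = 0 := by
  have cβ := continuous_radial hα1 hα2 β
  have cγ := continuous_radial hα1 hα2 γ
  have h : ∫ x in (0 : ℝ)..1, (β - γ) * (2 - α) ^ 2 * (radial α β x * radial α γ x) =
      (radial α β 1 * radialFlux α γ 1 - radial α γ 1 * radialFlux α β 1) -
      (radial α β 0 * radialFlux α γ 0 - radial α γ 0 * radialFlux α β 0) := by
    refine intervalIntegral.integral_eq_sub_of_hasDerivAt_of_le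
      (f := fun x => radial α β x * radialFlux α γ x - radial α γ x * radialFlux α β x)
      zero_le_one ?_ (fun x hx => ?_) ?_
    · exact ((cβ.mul (continuous_radialFlux hα1 hα2 γ)).sub
        (cγ.mul (continuous_radialFlux hα1 hα2 β))).continuousOn
    · have hx0 : x ≠ 0 := hx.1.ne'
      refine (((hasDerivAt_radial hα1 hα2 hx0).mul (hasDerivAt_radialFlux hα1 hα2 hx0)).sub
        ((hasDerivAt_radial hα1 hα2 hx0).mul
          (hasDerivAt_radialFlux hα1 hα2 hx0))).congr_deriv ?_
      ring
    · exact ((cβ.mul cγ).const_mul _).intervalIntegrable _ _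
  rw [intervalIntegral.integral_const_mul] at h
  simp only [radial_one, radialFlux_zero, hβ, hγ, zero_mul, mul_zero, sub_zero, mul_eq_zero] at h
  have : (2 - α) ≠ 0 := by linarith
  simpa [sub_ne_zero.2 hβγ, this] using h

/-- The multiplier `x u'` (Rellich's identity) evaluates the norm of a radial eigenfunction. -/
theorem integral_radial_sq {α β : ℝ} (hα1 : 1 ≤ α) (hα2 : α < 2) (hβ0 : 0 < β)
    (hβ : besselSeries (nu α) β = 0) :
    ∫ x in (0 : ℝ)..1, radial α β x ^ 2 = β * besselSeries (nu α + 1) β ^ 2 / (2 - α) := by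
  have c := continuous_radial hα1 hα2 β
  have cp := continuous_radialFlux hα1 hα2 β
  have h2 : 2 - α ≠ 0 := by linarith
  set R : ℝ → ℝ := fun x => |x| ^ (1 - α) * radialFlux α β x ^ 2 -
    (1 - α) * (radialFlux α β x * radial α β x) + β * (2 - α) ^ 2 * (x * radial α β x ^ 2) with hR
  -- the weight `|x|^(1-α)` is singular, but `radialFlux` vanishes to first order at `0`
  have e : (fun x => |x| ^ (1 - α) * radialFlux α β x ^ 2) = fun x =>
      |x| ^ (3 - α) * (β * (2 - α) * besselSeries (nu α + 1) (β * |x| ^ (2 - α))) ^ 2 := by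
    ext x
    rcases eq_or_ne x 0 with rfl | hx
    · simp [radialFlux, Real.zero_rpow (show 3 - α ≠ 0 by linarith)]
    · have : |x| ^ (3 - α) = |x| ^ (1 - α) * (x * x) := by
        rw [← abs_mul_abs_self x, ← mul_assoc, ← Real.rpow_add_one (abs_ne_zero.2 hx),
          ← Real.rpow_add_one (abs_ne_zero.2 hx)]
        ring_nf
      rw [this, radialFlux]
      ring
  have cR : Continuous R := by
    refine ((Continuous.sub ?_ ((cp.mul c).const_mul _))).add
      ((continuous_id.mul (c.pow 2)).const_mul _)
    rw [e]
    exact (continuous_abs_rpow (by linarith)).mul ((((continuous_besselSeries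
      (by linarith [nu_nonneg hα1 hα2])).comp
        ((continuous_abs_rpow (by linarith)).const_mul β)).const_mul _).pow 2)
  have h : ∫ x in (0 : ℝ)..1, β * (2 - α) ^ 3 * radial α β x ^ 2 = R 1 - R 0 := by
    refine intervalIntegral.integral_eq_sub_of_hasDerivAt_of_le
      zero_le_one cR.continuousOn (fun x hx => ?_) ?_
    · have hx0 : x ≠ 0 := hx.1.ne'
      have d := hasDerivAt_radial (β := β) hα1 hα2 hx0
      have dp := hasDerivAt_radialFlux (β := β) hα1 hα2 hx0
      refine ((((hasDerivAt_abs_rpow_of_ne_zero hx0 (1 - α)).mul (dp.pow 2)).sub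
        ((dp.mul d).const_mul (1 - α))).add
          (((hasDerivAt_id x).mul (d.pow 2)).const_mul (β * (2 - α) ^ 2))).congr_deriv ?_
      have e3 : |x| ^ (1 - α - 2) * x = |x| ^ (-α) := by
        nth_rw 2 [← abs_of_pos hx.1]
        rw [← Real.rpow_add_one (abs_ne_zero.2 hx0)]
        ring_nf
      have e2 : |x| ^ (1 - α) = |x| ^ (-α) * x := by
        nth_rw 3 [← abs_of_pos hx.1]
        rw [← Real.rpow_add_one (abs_ne_zero.2 hx0)]
        ring_nf
      simp only [Pi.pow_apply, id]
      rw [mul_assoc (1 - α), e3, e2]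
      push_cast
      ring
    · exact ((c.pow 2).const_mul _).intervalIntegrable _ _
  rw [intervalIntegral.integral_const_mul] at h
  simp only [hR, radial_one, radialFlux_one, radialFlux_zero, hβ] at h
  simp only [abs_one, Real.one_rpow] at h
  rw [eq_div_iff h2]
  have h3 : β * (2 - α) ^ 2 ≠ 0 := by positivity
  refine mul_left_cancel₀ h3 ?_
  linear_combination h

/-! ### Primitives of square integrable functions -/

theorem integrableOn_of_memLp {u : ℝ → ℝ} (hu : MemLp u 2 vol) : IntegrableOn u Omega :=
  hu.integrable (by norm_num)

theorem intervalIntegrable_of_memLp {u : ℝ → ℝ} (hu : MemLp u 2 vol) {a b : ℝ}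
    (ha : a ∈ Icc (-1 : ℝ) 1) (hb : b ∈ Icc (-1 : ℝ) 1) : IntervalIntegrable u volume a b := by
  have h : IntegrableOn u (Icc (-1) 1) :=
    (integrableOn_Icc_iff_integrableOn_Ioo).2 (integrableOn_of_memLp hu)
  exact (h.mono_set (uIcc_subset_Icc ha hb)).intervalIntegrable

theorem continuousOn_primitive {u : ℝ → ℝ} (hu : MemLp u 2 vol) :
    ContinuousOn (fun s => ∫ t in (0 : ℝ)..s, u t) (Icc (-1) 1) := by
  have := intervalIntegral.continuousOn_primitive_interval' (a := 0)
    (intervalIntegrable_of_memLp hu (a := -1) (b := 1) (by simp) (by simp)) (by simp)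
  simpa [uIcc_of_le] using this

theorem uIoc_zero_subset_Omega {s : ℝ} (hs : s ∈ Omega) : uIoc 0 s ⊆ Omega := by
  intro x hx
  rw [mem_uIoc] at hx
  have := hs.1
  have := hs.2
  constructor <;> rcases hx with h | h <;> linarith [h.1, h.2]

/-- The element `1_{(0,s]}` (or `1_{(s,0]}`) of `L²(-1,1)`. -/
def segment (s : ℝ) : X :=
  indicatorConstLp 2 (measurableSet_uIoc (a := (0 : ℝ)) (b := s)) (measure_ne_top vol _) (1 : ℝ)

theorem norm_segment {s : ℝ} (hs : s ∈ Omega) : ‖segment s‖ = √|s| := by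
  rw [segment, norm_indicatorConstLp (by norm_num) (by norm_num), measureReal_restrict_apply
    measurableSet_uIoc, inter_eq_left.2 (uIoc_zero_subset_Omega hs)]
  simp [Real.sqrt_eq_rpow, measureReal_def]

theorem inner_segment {s : ℝ} (hs : s ∈ Omega) (u : X) :
    inner ℝ (segment s) u = ∫ x in uIoc 0 s, u x := by
  rw [segment, L2.inner_indicatorConstLp_one, Measure.restrict_restrict measurableSet_uIoc,
    inter_eq_left.2 (uIoc_zero_subset_Omega hs)]

theorem abs_primitive_le {u : ℝ → ℝ} (hu : MemLp u 2 vol) {s : ℝ} (hs : s ∈ Omega) :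
    |∫ t in (0 : ℝ)..s, u t| ≤ ‖hu.toLp u‖ * √|s| := by
  have h1 : ∫ x in uIoc 0 s, u x = inner ℝ (segment s) (hu.toLp u) := by
    rw [inner_segment hs]
    have h : hu.toLp u =ᵐ[volume.restrict (uIoc 0 s)] u :=
      ae_restrict_of_ae_restrict_of_subset (uIoc_zero_subset_Omega hs) hu.coeFn_toLp
    exact integral_congr_ae h.symm
  have h2 := abs_real_inner_le_norm (segment s) (hu.toLp u)
  rw [← norm_segment hs, ← Real.norm_eq_abs,
    intervalIntegral.norm_integral_eq_norm_integral_uIoc, h1, Real.norm_eq_abs, mul_comm]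
  exact h2

/-! ### Uniqueness on the half interval -/

/-- Cauchy data at the regular endpoint `1` determine a solution of
`v' = x^(-α) F`, `F' = -lam v` on `(0,1]`. -/
theorem eq_zero_of_data_at_one {α lam : ℝ} {v F : ℝ → ℝ}
    (hv : ∀ x ∈ Ioc (0 : ℝ) 1, HasDerivAt v (|x| ^ (-α) * F x) x)
    (hF : ∀ x ∈ Ioc (0 : ℝ) 1, HasDerivAt F (-(lam * v x)) x) (v1 : v 1 = 0) (F1 : F 1 = 0)
    {x : ℝ} (hx : x ∈ Ioc (0 : ℝ) 1) : v x = 0 := by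
  have hsub : ∀ t ∈ Icc x 1, t ∈ Ioc (0 : ℝ) 1 := fun t ht => ⟨hx.1.trans_le ht.1, ht.2⟩
  have hcont : ContinuousOn (fun t : ℝ => |t| ^ (-α)) (Icc x 1) := by
    refine continuous_abs.continuousOn.rpow_const fun t ht => .inl ?_
    exact abs_ne_zero.2 (hsub t ht).1.ne'
  obtain ⟨C, hC⟩ := isCompact_Icc.exists_bound_of_continuousOn hcont
  set L : ℝ → ℝ × ℝ →L[ℝ] ℝ × ℝ := fun t =>
    ((|t| ^ (-α)) • ContinuousLinearMap.snd ℝ ℝ ℝ).prod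
      ((-lam) • ContinuousLinearMap.fst ℝ ℝ ℝ) with hL
  have hLn : ∀ t ∈ Ioc x 1, ‖L t‖₊ ≤ (max C |lam|).toNNReal := by
    intro t ht
    have hC' := hC t ⟨ht.1.le, ht.2⟩
    refine NNReal.le_toNNReal_of_coe_le ?_
    refine ContinuousLinearMap.opNorm_le_bound _ (le_max_of_le_right (abs_nonneg _)) fun z => ?_
    rw [hL, ContinuousLinearMap.prod_apply, Prod.norm_mk]
    refine max_le ?_ ?_
    · have := norm_snd_le z
      simp only [smul_apply, ContinuousLinearMap.coe_snd', norm_smul]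
      gcongr
      exact le_max_of_le_left hC'
    · have := norm_fst_le z
      simp only [smul_apply, ContinuousLinearMap.coe_fst', norm_smul, norm_neg]
      gcongr
      exact le_max_right _ _
  have key := ODE_solution_unique_of_mem_Icc_left (v := fun t => L t) (s := fun _ => univ)
    (K := (max C |lam|).toNNReal) (f := fun t => (v t, F t)) (g := fun _ => (0, 0)) (a := x)
    (b := 1) (fun t ht => ((L t).lipschitz.weaken (hLn t ht)).lipschitzOnWith)
    (fun t ht => ((hv t (hsub t ht)).continuousAt.prodMk
      (hF t (hsub t ht)).continuousAt).continuousWithinAt)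
    (fun t ht => by
      have := (hv t (hsub t ⟨ht.1.le, ht.2⟩)).prodMk (hF t (hsub t ⟨ht.1.le, ht.2⟩))
      refine this.hasDerivWithinAt.congr_deriv ?_
      simp [hL])
    (fun _ _ => mem_univ _) continuousOn_const
    (fun t _ => by
      have h : L t (0, 0) = 0 := (L t).map_zero
      rw [h]
      exact hasDerivWithinAt_const t (Iic t) ((0 : ℝ), (0 : ℝ)))
    (fun _ _ => mem_univ _) (by simp [v1, F1])
  exact congrArg Prod.fst (key ⟨le_rfl, hx.2⟩)

/-- Otherwise `radial α β` would have zero Cauchy data at `1` and vanish on `(0,1]`, although it is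
positive at `0`. -/
theorem radialFlux_one_ne_zero {α β : ℝ} (hα1 : 1 ≤ α) (hα2 : α < 2)
    (hβ : besselSeries (nu α) β = 0) : radialFlux α β 1 ≠ 0 := by
  intro h
  have h0 : ∀ x ∈ Ioc (0 : ℝ) 1, radial α β x = 0 := fun x hx =>
    eq_zero_of_data_at_one (fun y hy => hasDerivAt_radial hα1 hα2 hy.1.ne')
      (fun y hy => hasDerivAt_radialFlux hα1 hα2 hy.1.ne') (by rw [radial_one, hβ]) h hx
  have h1 : radial α β 0 = 0 := by
    have hcl : IsClosed {x | radial α β x = 0} :=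
      isClosed_eq (continuous_radial hα1 hα2 β) continuous_const
    have := hcl.closure_subset_iff.2 (fun x hx => h0 x hx)
    rw [closure_Ioc zero_ne_one] at this
    exact this ⟨le_rfl, zero_le_one⟩
  have h2 := besselSeries_pos_of_nonpos (nu_nonneg hα1 hα2) (z := 0) le_rfl
  rw [radial, abs_zero, Real.zero_rpow (by linarith), mul_zero] at h1
  exact h2.ne' h1

/-- The positive zeros of the Bessel series are simple. -/
theorem besselSeries_add_one_ne_zero {α β : ℝ} (hα1 : 1 ≤ α) (hα2 : α < 2)
    (hβ : besselSeries (nu α) β = 0) : besselSeries (nu α + 1) β ≠ 0 := by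
  intro h
  apply radialFlux_one_ne_zero hα1 hα2 hβ
  rw [radialFlux_one, h, mul_zero]

/-- A square integrable solution with vanishing flux at `0` and vanishing at `1` is a multiple of
the radial solution, and nonzero only if that one vanishes at `1`: the Wronskian of both is
constant, and tends to `0` at the degenerate endpoint. -/
theorem half_interval_solution {α β : ℝ} (hα1 : 1 ≤ α) (hα2 : α < 2) {v : ℝ → ℝ}
    (hL2 : MemLp v 2 vol)
    (hv : ∀ x ∈ Ioo (0 : ℝ) 1, v x =
      β * (2 - α) ^ 2 * ∫ s in x..1, |s| ^ (-α) * ∫ t in (0 : ℝ)..s, v t) :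
    (∀ x ∈ Ioo (0 : ℝ) 1, v x = 0) ∨
      besselSeries (nu α) β = 0 ∧ ∃ c, ∀ x ∈ Ioo (0 : ℝ) 1, v x = c * radial α β x := by
  set lam := β * (2 - α) ^ 2
  set V : ℝ → ℝ := fun s => ∫ t in (0 : ℝ)..s, v t with hV
  have cV : ContinuousOn V (Icc (-1) 1) := continuousOn_primitive hL2
  -- extending `V` by a constant beyond `1` makes `1` an interior point
  set f : ℝ → ℝ := fun s => |s| ^ (-α) * V (min s 1) with hf
  have cf : ContinuousOn f (Ioi 0) := by
    refine (continuous_abs.continuousOn.rpow_const fun t ht => .inl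
      (abs_ne_zero.2 (ne_of_gt ht))).mul (cV.comp (by fun_prop) fun t ht => ?_)
    have : (0 : ℝ) < t := ht
    exact ⟨le_min (by linarith) (by norm_num), min_le_right _ _⟩
  have ii {g : ℝ → ℝ} (hg : ContinuousOn g (Ioi 0)) {a b : ℝ} (ha : 0 < a) (hb : 0 < b) :
      IntervalIntegrable g volume a b := by
    refine (hg.mono fun t ht => ?_).intervalIntegrable
    exact (lt_min ha hb).trans_le ht.1
  have ftc {g : ℝ → ℝ} (hg : ContinuousOn g (Ioi 0)) {x : ℝ} (hx : 0 < x) :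
      HasDerivAt (fun y => ∫ s in (1 : ℝ)..y, g s) (g x) x :=
    intervalIntegral.integral_hasDerivAt_right (ii hg one_pos hx)
      (hg.stronglyMeasurableAtFilter isOpen_Ioi x hx) (hg.continuousAt (Ioi_mem_nhds hx))
  set w : ℝ → ℝ := fun x => -lam * ∫ s in (1 : ℝ)..x, f s with hw
  have dw {x : ℝ} (hx : 0 < x) : HasDerivAt w (-lam * f x) x := (ftc cf hx).const_mul _
  have cw : ContinuousOn w (Ioi 0) := fun x hx => (dw hx).continuousAt.continuousWithinAt
  have hvw : ∀ x ∈ Ioo (0 : ℝ) 1, v x = w x := by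
    intro x hx
    rw [hv x hx, hw]
    simp only
    rw [intervalIntegral.integral_symm x 1, neg_mul_neg]
    congr 1
    refine intervalIntegral.integral_congr fun s hs => ?_
    rw [uIcc_of_le hx.2.le] at hs
    simp only [hf, min_eq_left hs.2]
    rfl
  set F : ℝ → ℝ := fun x => -lam * (V 1 + ∫ s in (1 : ℝ)..x, w s) with hF
  have hFV : ∀ x ∈ Ioc (0 : ℝ) 1, F x = -lam * V x := by
    intro x hx
    have i1 := intervalIntegrable_of_memLp hL2 (a := 0) (b := 1) (by simp) (by simp)
    have i2 := intervalIntegrable_of_memLp hL2 (a := 1) (b := x) (by simp)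
      ⟨by linarith [hx.1], hx.2⟩
    have : ∫ s in (1 : ℝ)..x, w s = ∫ s in (1 : ℝ)..x, v s := by
      refine intervalIntegral.integral_congr_uIoo fun s hs => ?_
      rw [uIoo_of_ge hx.2] at hs
      exact (hvw s ⟨hx.1.trans hs.1, hs.2⟩).symm
    rw [hF]
    simp only [this, hV, intervalIntegral.integral_add_adjacent_intervals i1 i2]
  have dF : ∀ x ∈ Ioc (0 : ℝ) 1, HasDerivAt F (-(lam * w x)) x := fun x hx =>
    (((ftc cw hx.1).const_add (V 1)).const_mul (-lam)).congr_deriv (by ring)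
  have dw' : ∀ x ∈ Ioc (0 : ℝ) 1, HasDerivAt w (|x| ^ (-α) * F x) x := fun x hx =>
    (dw hx.1).congr_deriv (by rw [hFV x hx, hf]; simp only [min_eq_left hx.2]; ring)
  have w1 : w 1 = 0 := by simp [hw]
  have dΦ : ∀ x ∈ Ioc (0 : ℝ) 1, HasDerivAt (radial α β) (|x| ^ (-α) * radialFlux α β x) x :=
    fun x hx => hasDerivAt_radial hα1 hα2 hx.1.ne'
  have dp : ∀ x ∈ Ioc (0 : ℝ) 1, HasDerivAt (radialFlux α β) (-(lam * radial α β x)) x :=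
    fun x hx => hasDerivAt_radialFlux hα1 hα2 hx.1.ne'
  -- the Wronskian
  have hW : ∀ x ∈ Ioc (0 : ℝ) 1, radial α β x * F x - w x * radialFlux α β x =
      radial α β 1 * F 1 := by
    intro x hx
    have hsub : ∀ y ∈ uIcc x 1, y ∈ Ioc (0 : ℝ) 1 := fun y hy => by
      rw [uIcc_of_le hx.2] at hy
      exact ⟨hx.1.trans_le hy.1, hy.2⟩
    have := intervalIntegral.integral_eq_sub_of_hasDerivAt (a := x) (b := 1)
      (f := fun x => radial α β x * F x - w x * radialFlux α β x) (f' := fun _ => 0)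
      (fun y hy => (((dΦ y (hsub y hy)).mul (dF y (hsub y hy))).sub
        ((dw' y (hsub y hy)).mul (dp y (hsub y hy)))).congr_deriv (by ring))
      intervalIntegrable_const
    simp only [intervalIntegral.integral_zero, w1] at this
    linarith
  set C := ‖hL2.toLp v‖
  have hwb : ∀ x ∈ Ioo (0 : ℝ) 1, |w x| * x ≤ 2 * |lam| * C * √x := by
    intro x hx
    have hm : ∀ s ∈ Ioo x 1, ‖f s‖ ≤ C * s ^ (-(3 / 2) : ℝ) := by
      intro s hs
      have hs0 : 0 < s := hx.1.trans hs.1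
      have h1 := abs_primitive_le hL2 (s := s) ⟨by linarith, hs.2⟩
      rw [abs_of_pos hs0] at h1
      simp only [hf, min_eq_left hs.2.le, norm_mul, Real.norm_eq_abs]
      rw [abs_of_nonneg (Real.rpow_nonneg (abs_nonneg s) _), abs_of_pos hs0]
      have h2 : s ^ (-α) ≤ s ^ (-2 : ℝ) :=
        Real.rpow_le_rpow_of_exponent_ge hs0 hs.2.le (by linarith)
      calc s ^ (-α) * |V s| ≤ s ^ (-2 : ℝ) * (C * √s) := by gcongr
        _ = C * (s ^ (-2 : ℝ) * s ^ (1 / 2 : ℝ)) := by rw [Real.sqrt_eq_rpow]; ring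
        _ = _ := by rw [← Real.rpow_add hs0]; norm_num
    have h3 : |∫ s in x..1, f s| ≤ ∫ s in x..1, C * s ^ (-(3 / 2) : ℝ) := by
      rw [← Real.norm_eq_abs]
      refine intervalIntegral.norm_integral_le_of_norm_le hx.2.le ?_ ?_
      · filter_upwards [Measure.ae_ne volume 1] with s hs1 hs
        exact hm s ⟨hs.1, lt_of_le_of_ne hs.2 hs1⟩
      · refine ii ?_ hx.1 one_pos
        exact (continuousOn_id.rpow_const fun t ht => .inl (ne_of_gt ht)).const_mul _
    have h4 : ∫ s in x..1, C * s ^ (-(3 / 2) : ℝ) ≤ C * (2 * x ^ (-(1 / 2) : ℝ)) := by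
      rw [intervalIntegral.integral_const_mul, integral_rpow (.inr ⟨by norm_num, fun h => ?_⟩)]
      · have : (0 : ℝ) ≤ C := norm_nonneg _
        gcongr
        norm_num
        linarith
      · rw [uIcc_of_le hx.2.le] at h
        exact absurd h.1 (not_le.2 hx.1)
    have h5 : x ^ (-(1 / 2) : ℝ) * x = √x := by
      rw [← Real.rpow_add_one hx.1.ne', Real.sqrt_eq_rpow]
      norm_num
    have hx0 := hx.1
    calc |w x| * x = |lam| * |∫ s in x..1, f s| * x := by
          rw [hw]
          simp only
          rw [intervalIntegral.integral_symm x 1, neg_mul_neg, abs_mul]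
      _ ≤ |lam| * (C * (2 * x ^ (-(1 / 2) : ℝ))) * x := by
          gcongr
          exact h3.trans h4
      _ = 2 * |lam| * C * (x ^ (-(1 / 2) : ℝ) * x) := by ring
      _ = _ := by rw [h5]
  -- it vanishes at `0`
  have hlim : Filter.Tendsto (fun x => radial α β x * F x - w x * radialFlux α β x)
      (nhdsWithin 0 (Ioi 0)) (nhds 0) := by
    have hev : ∀ᶠ x in nhdsWithin (0 : ℝ) (Ioi 0), x ∈ Ioo (0 : ℝ) 1 :=
      Ioo_mem_nhdsGT one_pos
    have t1 : Filter.Tendsto F (nhdsWithin 0 (Ioi 0)) (nhds 0) := by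
      have h : Filter.Tendsto V (nhdsWithin 0 (Ioi 0)) (nhds (V 0)) :=
        (cV.continuousAt (Icc_mem_nhds (by norm_num) (by norm_num))).tendsto.mono_left
          nhdsWithin_le_nhds
      have h2 := h.const_mul (-lam)
      simp only [hV, intervalIntegral.integral_same, mul_zero] at h2
      refine h2.congr' ?_
      filter_upwards [hev] with x hx using (hFV x ⟨hx.1, hx.2.le⟩).symm
    have t2 : Filter.Tendsto (fun x => w x * x) (nhdsWithin 0 (Ioi 0)) (nhds 0) := by
      have h : Filter.Tendsto (fun x : ℝ => 2 * |lam| * C * √x) (nhdsWithin 0 (Ioi 0))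
          (nhds 0) := by
        have : Continuous fun x : ℝ => 2 * |lam| * C * √x := by fun_prop
        simpa using this.tendsto 0 |>.mono_left nhdsWithin_le_nhds
      refine squeeze_zero_norm' ?_ h
      filter_upwards [hev] with x hx
      rw [norm_mul, Real.norm_eq_abs, Real.norm_of_nonneg hx.1.le]
      exact hwb x hx
    have t3 := (continuous_radial hα1 hα2 β).tendsto 0 |>.mono_left
      (nhdsWithin_le_nhds (s := Ioi 0))
    have cb : Continuous fun x : ℝ =>
        -(β * (2 - α)) * besselSeries (nu α + 1) (β * |x| ^ (2 - α)) :=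
      ((continuous_besselSeries (by linarith [nu_nonneg hα1 hα2])).comp
        ((continuous_abs_rpow (by linarith)).const_mul β)).const_mul _
    have t4 := cb.tendsto 0 |>.mono_left (nhdsWithin_le_nhds (s := Ioi 0))
    have := (t3.mul t1).sub (t2.mul t4)
    simp only [mul_zero, zero_mul, sub_zero] at this
    refine this.congr fun x => ?_
    rw [radialFlux]
    ring
  have hW1 : radial α β 1 * F 1 = 0 := by
    refine tendsto_nhds_unique (tendsto_const_nhds.congr' ?_) hlim
    filter_upwards [Ioo_mem_nhdsGT (one_pos (α := ℝ))] with x hx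
    exact (hW x ⟨hx.1, hx.2.le⟩).symm
  rcases eq_or_ne (F 1) 0 with hF1 | hF1
  · left
    intro x hx
    rw [hvw x hx]
    exact eq_zero_of_data_at_one dw' dF w1 hF1 ⟨hx.1, hx.2.le⟩
  · right
    have hβ : besselSeries (nu α) β = 0 := by
      rw [← radial_one]
      exact (mul_eq_zero.1 hW1).resolve_right hF1
    have hp := radialFlux_one_ne_zero hα1 hα2 hβ
    refine ⟨hβ, F 1 / radialFlux α β 1, fun x hx => ?_⟩
    rw [hvw x hx, ← sub_eq_zero]
    set c := F 1 / radialFlux α β 1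
    refine eq_zero_of_data_at_one (α := α) (lam := lam) (v := fun x => w x - c * radial α β x)
      (F := fun x => F x - c * radialFlux α β x)
      (fun y hy => ((dw' y hy).sub ((dΦ y hy).const_mul c)).congr_deriv (by ring))
      (fun y hy => ((dF y hy).sub ((dp y hy).const_mul c)).congr_deriv (by ring)) ?_ ?_
      ⟨hx.1, hx.2.le⟩
    · simp [w1, radial_one, hβ]
    · simp [c, div_mul_cancel₀ _ hp]

/-! ### The integrated eigenvalue problem -/

/-- The function equal to `a` times the radial solution in `(0,1)` and to `b` times it in
`(-1,0)`. -/
def twoSided (α β a b x : ℝ) : ℝ :=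
  if 0 < x then a * radial α β x else if x < 0 then b * radial α β x else 0

/-- The eigenvalue problem integrated twice on each side of `0`, with vanishing flux at `0`. -/
structure IntegralSolution (α lam : ℝ) (v : ℝ → ℝ) : Prop where
  memLp : MemLp v 2 vol
  right : ∀ x ∈ Ioo (0 : ℝ) 1,
    v x = lam * ∫ s in x..1, |s| ^ (-α) * ∫ t in (0 : ℝ)..s, v t
  left : ∀ x ∈ Ioo (-1 : ℝ) 0,
    v x = -(lam * ∫ s in (-1 : ℝ)..x, |s| ^ (-α) * ∫ t in (0 : ℝ)..s, v t)

theorem measurePreserving_neg_vol : MeasurePreserving (fun x : ℝ => -x) vol vol := by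
  have h := (Measure.measurePreserving_neg (volume : Measure ℝ)).restrict_preimage
    (s := Omega) measurableSet_Ioo
  have e : Neg.neg ⁻¹' Omega = Omega := by
    ext x
    simp only [mem_preimage, mem_Ioo]
    constructor <;> rintro ⟨h1, h2⟩ <;> constructor <;> linarith
  rwa [e] at h

theorem IntegralSolution.eq_twoSided {α β : ℝ} (hα1 : 1 ≤ α) (hα2 : α < 2) {v : ℝ → ℝ}
    (hv : IntegralSolution α (β * (2 - α) ^ 2) v) :
    ∃ a b, (∀ x ∈ Omega, x ≠ 0 → v x = twoSided α β a b x) ∧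
      (besselSeries (nu α) β ≠ 0 → a = 0 ∧ b = 0) := by
  have key {w : ℝ → ℝ} (hw : MemLp w 2 vol) (h : ∀ x ∈ Ioo (0 : ℝ) 1, w x =
      β * (2 - α) ^ 2 * ∫ s in x..1, |s| ^ (-α) * ∫ t in (0 : ℝ)..s, w t) :
      ∃ c, (∀ x ∈ Ioo (0 : ℝ) 1, w x = c * radial α β x) ∧
        (besselSeries (nu α) β ≠ 0 → c = 0) := by
    rcases half_interval_solution hα1 hα2 hw h with h0 | ⟨h1, c, hc⟩
    · exact ⟨0, fun x hx => by rw [h0 x hx, zero_mul], fun _ => rfl⟩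
    · exact ⟨c, hc, fun h => absurd h1 h⟩
  obtain ⟨a, ha, ha'⟩ := key hv.memLp hv.right
  have hneg : MemLp (fun x => v (-x)) 2 vol :=
    hv.memLp.comp_measurePreserving measurePreserving_neg_vol
  obtain ⟨b, hb, hb'⟩ := key hneg fun x hx => by
    have e (s : ℝ) : ∫ t in (0 : ℝ)..s, v (-t) = -∫ t in (0 : ℝ)..(-s), v t := by
      rw [intervalIntegral.integral_comp_neg, neg_zero, intervalIntegral.integral_symm]
    simp only [e]
    rw [hv.left (-x) ⟨by linarith [hx.2], by linarith [hx.1]⟩, ← mul_neg]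
    congr 1
    have := intervalIntegral.integral_comp_neg (a := x) (b := 1)
      (fun s => |s| ^ (-α) * ∫ t in (0 : ℝ)..s, v t)
    simp only [abs_neg] at this
    rw [← this, ← intervalIntegral.integral_neg]
    simp only [mul_neg]
  refine ⟨a, b, fun x hx hx0 => ?_, fun h => ⟨ha' h, hb' h⟩⟩
  rcases lt_or_gt_of_ne hx0 with h | h
  · have := hb (-x) ⟨by linarith, by linarith [hx.1]⟩
    rw [neg_neg, radial_neg] at this
    rw [twoSided, if_neg h.not_gt, if_pos h, this]
  · rw [twoSided, if_pos h, ha x ⟨h, hx.2⟩]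

/-! ### Weak derivatives -/

theorem integral_Omega_eq (f : ℝ → ℝ) : ∫ x in Omega, f x = ∫ x in (-1 : ℝ)..1, f x := by
  rw [intervalIntegral.integral_of_le (by norm_num), integral_Ioc_eq_integral_Ioo]

/-- A function supported in a compact part of `(-1,1)` vanishes off some `[a,b] ⊆ (-1,1)`. -/
theorem exists_Icc_of_tsupport_subset {φ : ℝ → ℝ} (hc : HasCompactSupport φ)
    (hs : tsupport φ ⊆ Omega) : ∃ r ∈ Ioo (0 : ℝ) 1, ∀ x, r < |x| → φ x = 0 := by
  obtain ⟨r, hr, h⟩ : ∃ r ∈ Ioo (0 : ℝ) 1, ∀ x ∈ tsupport φ, |x| ≤ r := by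
    rcases (tsupport φ).eq_empty_or_nonempty with h | h
    · exact ⟨1 / 2, by norm_num, by simp [h]⟩
    · obtain ⟨y, hy, hmax⟩ := hc.isCompact.exists_isMaxOn h continuous_abs.continuousOn
      have hy1 : |y| < 1 := abs_lt.2 (hs hy)
      refine ⟨(|y| + 1) / 2, ⟨by positivity, by linarith⟩, fun x hx => ?_⟩
      have : |x| ≤ |y| := hmax hx
      linarith
  refine ⟨r, hr, fun x hx => ?_⟩
  by_contra h0
  exact absurd (h x (subset_tsupport φ h0)) (not_le.2 hx)

theorem tsupport_subset_Omega {φ : ℝ → ℝ} {r : ℝ} (hr : r < 1)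
    (h : ∀ x, r < |x| → φ x = 0) : HasCompactSupport φ ∧ tsupport φ ⊆ Omega := by
  have h1 : Function.support φ ⊆ Icc (-r) r := fun x hx => by
    rw [mem_Icc, ← abs_le]
    by_contra h'
    exact hx (h x (not_le.1 h'))
  have h2 : tsupport φ ⊆ Icc (-r) r := closure_minimal h1 isClosed_Icc
  refine ⟨HasCompactSupport.of_support_subset_isCompact isCompact_Icc h1, h2.trans fun x hx => ?_⟩
  exact ⟨by linarith [hx.1], by linarith [hx.2]⟩

/-- A test function with vanishing integral is the derivative of a test function. -/
theorem exists_test_primitive {θ : ℝ → ℝ} (hθ : ContDiff ℝ ∞ θ) {r : ℝ} (hr : r ∈ Ioo (0 : ℝ) 1)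
    (h : ∀ x, r < |x| → θ x = 0) (h0 : ∫ x in (-1 : ℝ)..1, θ x = 0) :
    ∃ φ : ℝ → ℝ, ContDiff ℝ ∞ φ ∧ HasCompactSupport φ ∧ tsupport φ ⊆ Omega ∧ deriv φ = θ := by
  have hc := hθ.continuous
  have hd (x : ℝ) : HasDerivAt (fun y => ∫ t in (-1 : ℝ)..y, θ t) (θ x) x :=
    intervalIntegral.integral_hasDerivAt_right (hc.intervalIntegrable _ _)
      (hc.stronglyMeasurableAtFilter _ _) hc.continuousAt
  have hderiv : deriv (fun y => ∫ t in (-1 : ℝ)..y, θ t) = θ := funext fun x => (hd x).deriv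
  have hz : ∀ x, r < |x| → ∫ t in (-1 : ℝ)..x, θ t = 0 := by
    intro x hx
    rcases lt_abs.1 hx with hx | hx
    · have e : ∫ t in x..1, θ t = 0 := by
        refine (intervalIntegral.integral_congr fun t ht => ?_).trans
          intervalIntegral.integral_zero
        exact h t ((lt_min hx hr.2).trans_le (ht.1.trans (le_abs_self t)))
      have := intervalIntegral.integral_add_adjacent_intervals
        (hc.intervalIntegrable (μ := volume) (-1) x) (hc.intervalIntegrable x 1)
      linarith
    · refine (intervalIntegral.integral_congr fun t ht => ?_).trans
        intervalIntegral.integral_zero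
      refine h t (lt_abs.2 (.inr ?_))
      have h1 : t ≤ max (-1) x := ht.2
      have h2 : max (-1) x < -r := max_lt (by linarith [hr.2]) (by linarith)
      linarith
  obtain ⟨h1, h2⟩ := tsupport_subset_Omega hr.2 hz
  refine ⟨_, contDiff_infty_iff_deriv.2 ⟨fun x => (hd x).differentiableAt, ?_⟩, h1, h2, hderiv⟩
  rwa [hderiv]

/-- The lemma of du Bois-Reymond: a function with vanishing weak derivative is constant. -/
theorem ae_eq_const_of_weakDeriv_zero {H : ℝ → ℝ} (hH : LocallyIntegrableOn H Omega)
    (h : ∀ φ : ℝ → ℝ, ContDiff ℝ ∞ φ → HasCompactSupport φ → tsupport φ ⊆ Omega →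
      ∫ x in Omega, H x * deriv φ x = 0) : ∃ c, H =ᵐ[vol] fun _ => c := by
  let f : ContDiffBump (0 : ℝ) := ⟨1 / 4, 1 / 2, by norm_num, by norm_num⟩
  set ρ : ℝ → ℝ := f.normed volume with hρ
  have ρs : ContDiff ℝ ∞ ρ := f.contDiff_normed
  have ρz : ∀ x, 1 / 2 < |x| → ρ x = 0 := fun x hx => by
    by_contra h0
    have : x ∈ Function.support ρ := h0
    rw [hρ, f.support_normed_eq, mem_ball_zero_iff] at this
    exact lt_asymm hx this
  obtain ⟨ρc, ρt⟩ := tsupport_subset_Omega (by norm_num) ρz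
  have ρi : ∫ x in Omega, ρ x = 1 := by
    rw [setIntegral_eq_integral_of_forall_compl_eq_zero, hρ, f.integral_normed]
    exact fun x hx => image_eq_zero_of_notMem_tsupport fun h' => hx (ρt h')
  set c := ∫ x in Omega, H x * ρ x with hcdef
  have hcl : LocallyIntegrableOn (fun _ : ℝ => c) Omega := locallyIntegrableOn_const c
  refine ⟨c, ?_⟩
  have key := isOpen_Ioo.ae_eq_zero_of_integral_contDiff_smul_eq_zero (μ := volume) (U := Omega)
    (hH.sub hcl) ?_
  · rw [Filter.EventuallyEq, ae_restrict_iff' measurableSet_Ioo]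
    filter_upwards [key] with x hx hxm
    exact sub_eq_zero.1 (hx hxm)
  intro ψ ψs ψc ψt
  obtain ⟨r, hr, ψz⟩ := exists_Icc_of_tsupport_subset ψc ψt
  have iψ : IntegrableOn ψ Omega := (ψs.continuous.integrable_of_hasCompactSupport ψc).integrableOn
  have iρ : IntegrableOn ρ Omega := (ρs.continuous.integrable_of_hasCompactSupport ρc).integrableOn
  set m := ∫ x in Omega, ψ x with hm
  obtain ⟨φ, φs, φc, φt, hφ⟩ := exists_test_primitive (θ := fun x => ψ x - m * ρ x)
    (r := max r (1 / 2)) (ψs.sub (contDiff_const.mul ρs))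
    ⟨lt_max_of_lt_left hr.1, max_lt hr.2 (by norm_num)⟩
    (fun x hx => by
      rw [ψz x ((le_max_left _ _).trans_lt hx), ρz x ((le_max_right _ _).trans_lt hx)]
      simp)
    (by
      rw [← integral_Omega_eq, integral_sub iψ (iρ.const_mul m), integral_const_mul, ρi]
      simp [hm])
  have i1 := integrable_mul_test hH ψs.continuous ψc ψt
  have i2 := integrable_mul_test hH ρs.continuous ρc ρt
  have e := h φ φs φc φt
  have e2 : ∫ x in Omega, H x * deriv φ x = (∫ x in Omega, H x * ψ x) - m * c := by
    rw [hcdef, ← integral_const_mul, ← integral_sub i1 (i2.const_mul m)]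
    refine integral_congr_ae (.of_forall fun x => ?_)
    simp only [hφ]
    ring
  change ∫ x, ψ x • (H x - c) = 0
  have hz : ∀ x ∉ Omega, ψ x • (H x - c) = 0 := fun x hx => by
    rw [image_eq_zero_of_notMem_tsupport fun h' => hx (ψt h'), zero_smul]
  rw [← setIntegral_eq_integral_of_forall_compl_eq_zero hz]
  have e3 : ∫ x in Omega, ψ x • (H x - c) = (∫ x in Omega, H x * ψ x) - c * m := by
    rw [hm, ← integral_const_mul, ← integral_sub i1 (iψ.const_mul c)]
    refine integral_congr_ae (.of_forall fun x => ?_)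
    simp only [smul_eq_mul]
    ring
  rw [e3]
  linarith

theorem weakDeriv_primitive {v φ : ℝ → ℝ} (hv : MemLp v 2 vol) (hφ : ContDiff ℝ ∞ φ)
    (ht : tsupport φ ⊆ Omega) :
    ∫ x in Omega, (∫ t in (0 : ℝ)..x, v t) * deriv φ x = -∫ x in Omega, v x * φ x := by
  have iv := intervalIntegrable_of_memLp hv (a := -1) (b := 1) (by simp) (by simp)
  have ac : AbsolutelyContinuousOnInterval (fun x => ∫ t in (0 : ℝ)..x, v t) (-1) 1 :=
    iv.absolutelyContinuousOnInterval_intervalIntegral (c := 0) (by simp)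
  have acφ : AbsolutelyContinuousOnInterval φ (-1) 1 :=
    ((hφ.of_le (by simp)).contDiffOn (n := 1)).absolutelyContinuousOnInterval
  have h1 : φ 1 = 0 := image_eq_zero_of_notMem_tsupport fun h => lt_irrefl _ (ht h).2
  have h2 : φ (-1) = 0 := image_eq_zero_of_notMem_tsupport fun h => lt_irrefl _ (ht h).1
  rw [integral_Omega_eq, integral_Omega_eq, ac.integral_mul_deriv_eq_deriv_mul acφ, h1, h2]
  simp only [mul_zero, sub_zero, zero_sub, neg_inj]
  refine intervalIntegral.integral_congr_ae ?_
  filter_upwards [iv.ae_hasDerivAt_integral] with x hx hxm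
  rw [(hx (uIoc_subset_uIcc hxm) 0 (by simp)).deriv]

/-! ### Solutions solve the integrated problem -/

/-- The flux of a solution of the eigenvalue problem vanishes at `0`: otherwise the energy density
would be comparable to `|x|^(-α)`, which is not integrable for `1 ≤ α`. -/
theorem Solves.flux_eq {α lam : ℝ} (hα1 : 1 ≤ α) {v : ℝ → ℝ} (hv : Solves α lam v) :
    flux α v =ᵐ[vol] fun x => -lam * ∫ t in (0 : ℝ)..x, v t := by
  obtain ⟨⟨h1, -⟩, hF, -, hw⟩ := hv
  have hL2 := h1.memLp
  set V : ℝ → ℝ := fun x => ∫ t in (0 : ℝ)..x, v t with hV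
  have cV : ContinuousOn V Omega := (continuousOn_primitive hL2).mono Ioo_subset_Icc_self
  have lV : LocallyIntegrableOn V Omega := cV.locallyIntegrableOn measurableSet_Ioo
  obtain ⟨c, hc⟩ := ae_eq_const_of_weakDeriv_zero (H := flux α v + lam • V)
    (hF.add (lV.smul lam)) fun φ φs φc φt => by
      have d1 : Continuous (deriv φ) := φs.continuous_deriv (by simp)
      have d3 : tsupport (deriv φ) ⊆ Omega :=
        (closure_minimal support_deriv_subset (isClosed_tsupport φ)).trans φt
      have i1 := integrable_mul_test hF d1 φc.deriv d3
      have i2 := integrable_mul_test lV d1 φc.deriv d3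
      simp only [Pi.add_apply, Pi.smul_apply, smul_eq_mul, add_mul, mul_assoc]
      rw [integral_add i1 (i2.const_mul lam), integral_const_mul, weakDeriv_primitive hL2 φs φt,
        hw φ φs φc φt]
      simp only [neg_mul, mul_assoc]
      rw [integral_neg, integral_const_mul]
      ring
  have hfl : ∀ᵐ x ∂vol, flux α v x = c - lam * V x := by
    filter_upwards [hc] with x hx
    simp only [Pi.add_apply, Pi.smul_apply, smul_eq_mul] at hx
    linarith
  suffices hc0 : c = 0 by
    filter_upwards [hfl] with x hx
    rw [hx, hc0]
    ring
  by_contra hc0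
  have hcpos : 0 < |c| := abs_pos.2 hc0
  -- near `0` the flux is at least `|c|/2`
  obtain ⟨δ, hδ, hδ1, hb⟩ : ∃ δ > 0, δ < 1 ∧ ∀ x ∈ Ioo 0 δ, |lam * V x| ≤ |c| / 2 := by
    have hcont : ContinuousAt (fun x => |lam * V x|) 0 :=
      ((cV.continuousAt (Ioo_mem_nhds (by norm_num) (by norm_num))).const_mul lam).abs
    have hlt : |lam * V 0| < |c| / 2 := by simp [hV, hcpos]
    obtain ⟨ε, hε, hb⟩ := Metric.eventually_nhds_iff.1 (hcont.eventually_lt_const hlt)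
    refine ⟨min ε (1 / 2), by positivity, by
      exact (min_le_right _ _).trans_lt (by norm_num), fun x hx => (hb ?_).le⟩
    rw [Real.dist_eq, sub_zero, abs_of_pos hx.1]
    exact hx.2.trans_le (min_le_left _ _)
  have hsub : Ioo 0 δ ⊆ Omega := fun x hx => ⟨by linarith [hx.1], by linarith [hx.2]⟩
  have hint : IntegrableOn (fun x : ℝ => x ^ (-α)) (Ioo 0 δ) := by
    have hE := (h1.energy.mono_set hsub).const_mul (4 / c ^ 2)
    refine Integrable.mono' hE (by fun_prop) ?_
    have hfl' := ae_restrict_of_ae_restrict_of_subset hsub hfl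
    filter_upwards [hfl', ae_restrict_mem measurableSet_Ioo] with x hx hxm
    have hx0 := hxm.1
    have hp : 0 < x ^ α := Real.rpow_pos_of_pos hx0 α
    rw [flux, abs_of_pos hx0] at hx
    rw [Real.norm_of_nonneg (by positivity), abs_of_pos hx0, Real.rpow_neg hx0.le]
    have h2 : |c| / 2 ≤ |c - lam * V x| := by
      have := abs_sub_abs_le_abs_sub c (lam * V x)
      linarith [hb x hxm]
    have h3 : c ^ 2 / 4 ≤ (c - lam * V x) ^ 2 := by
      have := pow_le_pow_left₀ (by positivity) h2 2
      rw [sq_abs, div_pow, sq_abs] at this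
      linarith
    have h4 : x ^ α * deriv v x ^ 2 = (c - lam * V x) ^ 2 / x ^ α := by
      rw [← hx]
      field_simp
    rw [h4, inv_eq_one_div, ← mul_div_assoc]
    have hc2 : 0 < c ^ 2 := by positivity
    gcongr
    rw [div_mul_eq_mul_div, one_le_div hc2]
    linarith
  have := (intervalIntegral.integrableOn_Ioo_rpow_iff hδ).1 hint
  linarith

theorem Solves.integralSolution {α lam : ℝ} (hα1 : 1 ≤ α) {v : ℝ → ℝ} (hv : Solves α lam v) :
    IntegralSolution α lam v := by
  have h1 := hv.1.1
  have hd : ∀ᵐ x, x ∈ Omega →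
      deriv v x = -lam * (|x| ^ (-α) * ∫ t in (0 : ℝ)..x, v t) := by
    have := (ae_restrict_iff' measurableSet_Ioo).1 (hv.flux_eq hα1)
    filter_upwards [this, Measure.ae_ne volume 0] with x hx hx0 hxm
    have hp : 0 < |x| ^ α := Real.rpow_pos_of_pos (abs_pos.2 hx0) α
    have := hx hxm
    rw [flux] at this
    rw [Real.rpow_neg (abs_nonneg x)]
    field_simp
    linarith
  have hi {a b : ℝ} (ha : -1 ≤ a) (hab : a ≤ b) (hb : b ≤ 1) :
      ∫ x in a..b, deriv v x =
        -lam * ∫ x in a..b, |x| ^ (-α) * ∫ t in (0 : ℝ)..x, v t := by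
    rw [← intervalIntegral.integral_const_mul]
    refine intervalIntegral.integral_congr_ae ?_
    filter_upwards [hd, Measure.ae_ne volume 1] with x hx hx1 hxm
    rw [uIoc_of_le hab] at hxm
    exact hx ⟨ha.trans_lt hxm.1, lt_of_le_of_ne (hxm.2.trans hb) hx1⟩
  refine ⟨h1.memLp, fun x hx => ?_, fun x hx => ?_⟩
  · have := (h1.ac_right x hx).integral_deriv_eq_sub
    rw [hi (by linarith [hx.1]) hx.2.le le_rfl, h1.right_eq_zero] at this
    linarith
  · have := (h1.ac_left (-x) ⟨by linarith [hx.2], by linarith [hx.1]⟩).integral_deriv_eq_sub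
    rw [neg_neg, hi le_rfl hx.1.le (by linarith [hx.2]), h1.left_eq_zero] at this
    linarith

/-! ### Two-sided radial functions solve the problem -/

/-- The flux of `twoSided α β a b`. -/
def twoSidedFlux (α β a b x : ℝ) : ℝ := (if 0 < x then a else b) * radialFlux α β x

theorem continuous_twoSidedFlux {α : ℝ} (hα1 : 1 ≤ α) (hα2 : α < 2) (β a b : ℝ) :
    Continuous (twoSidedFlux α β a b) := by
  have cp := continuous_radialFlux hα1 hα2 β
  have e : twoSidedFlux α β a b =
      fun x => if x ≤ 0 then b * radialFlux α β x else a * radialFlux α β x := by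
    ext x
    rw [twoSidedFlux]
    split_ifs <;> first | rfl | (exfalso; linarith)
  rw [e]
  refine Continuous.if_le (by fun_prop) (by fun_prop) continuous_id continuous_const ?_
  rintro x rfl
  simp [radialFlux_zero]

theorem twoSided_eventuallyEq_of_pos {α β a b x : ℝ} (hx : 0 < x) :
    twoSided α β a b =ᶠ[nhds x] fun y => a * radial α β y := by
  filter_upwards [lt_mem_nhds hx] with y hy
  rw [twoSided, if_pos hy]

theorem twoSided_eventuallyEq_of_neg {α β a b x : ℝ} (hx : x < 0) :
    twoSided α β a b =ᶠ[nhds x] fun y => b * radial α β y := by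
  filter_upwards [gt_mem_nhds hx] with y hy
  rw [twoSided, if_neg (not_lt.2 (le_of_lt hy)), if_pos hy]

theorem hasDerivAt_twoSided {α β x : ℝ} (hα1 : 1 ≤ α) (hα2 : α < 2) (a b : ℝ) (hx : x ≠ 0) :
    HasDerivAt (twoSided α β a b) (|x| ^ (-α) * twoSidedFlux α β a b x) x := by
  have d := hasDerivAt_radial (β := β) hα1 hα2 hx
  rcases lt_or_gt_of_ne hx with h | h
  · refine ((d.const_mul b).congr_of_eventuallyEq (twoSided_eventuallyEq_of_neg h)).congr_deriv ?_
    rw [twoSidedFlux, if_neg h.not_gt]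
    ring
  · refine ((d.const_mul a).congr_of_eventuallyEq (twoSided_eventuallyEq_of_pos h)).congr_deriv ?_
    rw [twoSidedFlux, if_pos h]
    ring

theorem hasDerivAt_twoSidedFlux {α β x : ℝ} (hα1 : 1 ≤ α) (hα2 : α < 2) (a b : ℝ) (hx : x ≠ 0) :
    HasDerivAt (twoSidedFlux α β a b) (-(β * (2 - α) ^ 2 * twoSided α β a b x)) x := by
  have d := hasDerivAt_radialFlux (β := β) hα1 hα2 hx
  rcases lt_or_gt_of_ne hx with h | h
  · refine ((d.const_mul b).congr_of_eventuallyEq ?_).congr_deriv ?_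
    · filter_upwards [gt_mem_nhds h] with y hy
      rw [twoSidedFlux, if_neg (not_lt.2 (le_of_lt hy))]
    · rw [twoSided, if_neg h.not_gt, if_pos h]
      ring
  · refine ((d.const_mul a).congr_of_eventuallyEq ?_).congr_deriv ?_
    · filter_upwards [lt_mem_nhds h] with y hy
      rw [twoSidedFlux, if_pos hy]
    · rw [twoSided, if_pos h]
      ring

theorem measurable_twoSided {α : ℝ} (hα1 : 1 ≤ α) (hα2 : α < 2) (β a b : ℝ) :
    Measurable (twoSided α β a b) := by
  have c := (continuous_radial hα1 hα2 β).measurable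
  exact (c.const_mul a).ite measurableSet_Ioi ((c.const_mul b).ite measurableSet_Iio
    measurable_const)

theorem exists_bound_twoSided {α : ℝ} (hα1 : 1 ≤ α) (hα2 : α < 2) (β a b : ℝ) :
    ∃ C, ∀ x ∈ Icc (-1 : ℝ) 1, |twoSided α β a b x| ≤ C := by
  obtain ⟨C, hC⟩ := (isCompact_Icc (a := (-1 : ℝ)) (b := 1)).exists_bound_of_continuousOn
    (continuous_radial hα1 hα2 β).continuousOn
  refine ⟨(|a| + |b|) * C, fun x hx => ?_⟩
  have h := hC x hx
  rw [Real.norm_eq_abs] at h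
  have := abs_nonneg (radial α β x)
  rw [twoSided]
  split_ifs
  · rw [abs_mul]
    gcongr
    linarith [abs_nonneg b]
  · rw [abs_mul]
    gcongr
    linarith [abs_nonneg a]
  · rw [abs_zero]
    have : 0 ≤ C := this.trans h
    positivity

theorem memLp_twoSided {α : ℝ} (hα1 : 1 ≤ α) (hα2 : α < 2) (β a b : ℝ) :
    MemLp (twoSided α β a b) 2 vol := by
  obtain ⟨C, hC⟩ := exists_bound_twoSided hα1 hα2 β a b
  refine MemLp.of_bound (measurable_twoSided hα1 hα2 β a b).aestronglyMeasurable C ?_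
  filter_upwards [ae_restrict_mem measurableSet_Ioo] with x hx
  exact hC x (Ioo_subset_Icc_self hx)

theorem contDiffOn_radial {α : ℝ} (hα1 : 1 ≤ α) (hα2 : α < 2) (β : ℝ) :
    ContDiffOn ℝ 1 (radial α β) {0}ᶜ := by
  have hν := nu_nonneg hα1 hα2
  have h1 : ContDiff ℝ 1 (besselSeries (nu α)) := by
    refine contDiff_one_iff_deriv.2
      ⟨fun z => (hasDerivAt_besselSeries hν z).differentiableAt, ?_⟩
    rw [funext fun z => (hasDerivAt_besselSeries hν z).deriv]
    exact (continuous_besselSeries (by linarith)).neg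
  refine h1.comp_contDiffOn (contDiffOn_const.mul fun x hx => ?_)
  exact ((contDiffAt_abs hx).rpow_const_of_ne (abs_ne_zero.2 hx)).contDiffWithinAt

theorem integrable_vol_of_continuous {f : ℝ → ℝ} (hf : Continuous f) : IntegrableOn f Omega :=
  (hf.integrableOn_Icc (a := -1) (b := 1)).mono_set Ioo_subset_Icc_self

theorem energy_twoSided {α : ℝ} (hα1 : 1 ≤ α) (hα2 : α < 2) (β a b : ℝ) :
    IntegrableOn (fun x => |x| ^ α * deriv (twoSided α β a b) x ^ 2) Omega := by
  set B : ℝ → ℝ := fun x => (a ^ 2 + b ^ 2) * ((β * (2 - α)) ^ 2 *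
    (|x| ^ (2 - α) * besselSeries (nu α + 1) (β * |x| ^ (2 - α)) ^ 2)) with hB
  have cB : Continuous B := ((((continuous_abs_rpow (by linarith)).mul
    (((continuous_besselSeries (by linarith [nu_nonneg hα1 hα2])).comp
      ((continuous_abs_rpow (by linarith)).const_mul β)).pow 2)).const_mul _).const_mul _)
  refine Integrable.mono' (integrable_vol_of_continuous cB) ?_ ?_
  · have : Measurable fun x : ℝ => |x| ^ α := by fun_prop
    exact (this.mul ((measurable_deriv _).pow_const 2)).aestronglyMeasurable
  · filter_upwards [ae_restrict_of_ae (Measure.ae_ne volume 0)] with x hx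
    have hx0 := abs_pos.2 hx
    have hp : 0 ≤ |x| ^ α := Real.rpow_nonneg (abs_nonneg x) α
    rw [Real.norm_of_nonneg (by positivity), (hasDerivAt_twoSided hα1 hα2 a b hx).deriv,
      twoSidedFlux, radialFlux, hB]
    set c := if 0 < x then a else b
    have hc : c ^ 2 ≤ a ^ 2 + b ^ 2 := by
      simp only [c]
      split_ifs <;> nlinarith [sq_nonneg a, sq_nonneg b]
    have e : |x| ^ α * (|x| ^ (-α) * |x| ^ (-α)) * (|x| * |x|) = |x| ^ (2 - α) := by
      rw [← Real.rpow_add hx0, ← Real.rpow_add hx0, ← mul_assoc, ← Real.rpow_add_one hx0.ne',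
        ← Real.rpow_add_one hx0.ne']
      ring_nf
    set D := besselSeries (nu α + 1) (β * |x| ^ (2 - α))
    calc _ = c ^ 2 * ((β * (2 - α)) ^ 2 *
          (|x| ^ α * (|x| ^ (-α) * |x| ^ (-α)) * (|x| * |x|) * D ^ 2)) := by
          rw [abs_mul_abs_self]
          ring
      _ ≤ _ := by
          rw [e]
          exact mul_le_mul_of_nonneg_right hc (by positivity)

theorem memH1_twoSided {α β : ℝ} (hα1 : 1 ≤ α) (hα2 : α < 2) (hβ : besselSeries (nu α) β = 0)
    (a b : ℝ) : MemH1 α (twoSided α β a b) where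
  memLp := memLp_twoSided hα1 hα2 β a b
  ac_right ε hε := by
    refine ContDiffOn.absolutelyContinuousOnInterval ?_
    rw [uIcc_of_le hε.2.le]
    have hs : Icc ε 1 ⊆ {0}ᶜ := fun x hx => (hε.1.trans_le hx.1).ne'
    refine (contDiffOn_const.mul ((contDiffOn_radial hα1 hα2 β).mono hs)).congr
      (f := fun x => a * radial α β x) fun x hx => ?_
    rw [twoSided, if_pos (hε.1.trans_le hx.1)]
  ac_left ε hε := by
    refine ContDiffOn.absolutelyContinuousOnInterval ?_
    rw [uIcc_of_le (by linarith [hε.2])]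
    have hneg : ∀ x ∈ Icc (-1) (-ε), x < 0 := fun x hx => by linarith [hx.2, hε.1]
    refine (contDiffOn_const.mul ((contDiffOn_radial hα1 hα2 β).mono
      fun x hx => (hneg x hx).ne)).congr (f := fun x => b * radial α β x) fun x hx => ?_
    rw [twoSided, if_neg (hneg x hx).not_gt, if_pos (hneg x hx)]
  energy := energy_twoSided hα1 hα2 β a b
  left_eq_zero := by
    rw [twoSided, if_neg (by norm_num), if_pos (by norm_num), radial_neg, radial_one, hβ, mul_zero]
  right_eq_zero := by rw [twoSided, if_pos one_pos, radial_one, hβ, mul_zero]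

theorem flux_twoSided {α β : ℝ} (hα1 : 1 ≤ α) (hα2 : α < 2) (a b : ℝ) :
    twoSidedFlux α β a b =ᵐ[vol] flux α (twoSided α β a b) := by
  filter_upwards [ae_restrict_of_ae (Measure.ae_ne volume 0)] with x hx
  rw [flux, (hasDerivAt_twoSided hα1 hα2 a b hx).deriv, ← mul_assoc,
    ← Real.rpow_add (abs_pos.2 hx), add_neg_cancel, Real.rpow_zero, one_mul]

theorem hasWeakDeriv_twoSidedFlux {α β : ℝ} (hα1 : 1 ≤ α) (hα2 : α < 2) (a b : ℝ) :
    HasWeakDeriv (twoSidedFlux α β a b) fun x => -(β * (2 - α) ^ 2 * twoSided α β a b x) := by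
  have cF := continuous_twoSidedFlux hα1 hα2 β a b
  have hm := memLp_twoSided hα1 hα2 β a b
  have i1 : IntegrableOn (fun x => -(β * (2 - α) ^ 2 * twoSided α β a b x)) Omega :=
    ((integrableOn_of_memLp hm).const_mul _).neg
  refine ⟨cF.locallyIntegrable.locallyIntegrableOn _, i1.locallyIntegrableOn,
    fun φ φs φc φt => ?_⟩
  have d1 : Continuous (deriv φ) := φs.continuous_deriv (by simp)
  have d3 : tsupport (deriv φ) ⊆ Omega :=
    (closure_minimal support_deriv_subset (isClosed_tsupport φ)).trans φt
  have j1 := integrable_mul_test (cF.locallyIntegrable.locallyIntegrableOn Omega) d1 φc.deriv d3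
  have j2 := integrable_mul_test i1.locallyIntegrableOn φs.continuous φc φt
  have h1 : φ 1 = 0 := image_eq_zero_of_notMem_tsupport fun h => lt_irrefl _ (φt h).2
  have h2 : φ (-1) = 0 := image_eq_zero_of_notMem_tsupport fun h => lt_irrefl _ (φt h).1
  have key := MeasureTheory.integral_eq_of_hasDerivAt_off_countable (a := -1) (b := 1) (s := {0})
    (fun x => twoSidedFlux α β a b x * φ x)
    (fun x => -(β * (2 - α) ^ 2 * twoSided α β a b x) * φ x + twoSidedFlux α β a b x * deriv φ x)
    (countable_singleton 0) (cF.mul φs.continuous).continuousOn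
    (fun x hx => (hasDerivAt_twoSidedFlux hα1 hα2 a b hx.2).mul
      ((φs.differentiable (by simp)) x).hasDerivAt)
    (by
      have := j2.add j1
      rw [intervalIntegrable_iff_integrableOn_Ioo_of_le (by norm_num)]
      exact this)
  rw [← integral_Omega_eq, integral_add j2 j1, h1, h2] at key
  linarith

theorem solves_twoSided {α β : ℝ} (hα1 : 1 ≤ α) (hα2 : α < 2) (hβ : besselSeries (nu α) β = 0)
    (a b : ℝ) : Solves α (β * (2 - α) ^ 2) (twoSided α β a b) := by
  have h := (hasWeakDeriv_twoSidedFlux (β := β) hα1 hα2 a b).congr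
    (flux_twoSided hα1 hα2 a b) .rfl
  exact ⟨⟨memH1_twoSided hα1 hα2 hβ a b, _,
    ((memLp_twoSided hα1 hα2 β a b).const_mul _).neg, h⟩, h⟩

/-! ### Hilbert–Schmidt operators -/

/-- For `k ∈ L²(μ; E)` and a bilinear form `B`, the operator `u ↦ B u (k ·)` into `L²(μ)` is
compact: it has rank one if `k` is a vector times an indicator function, and such `k` span a dense
subspace of `L²(μ; E)`. -/
theorem isCompactOperator_compLpL₂_flip {Ω G E : Type*} [MeasurableSpace Ω] {μ : Measure Ω}
    [NormedAddCommGroup G] [NormedSpace ℝ G] [NormedAddCommGroup E] [NormedSpace ℝ E]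
    (B : G →L[ℝ] E →L[ℝ] ℝ) (k : Lp E 2 μ) :
    IsCompactOperator ((B.compLpL₂ 2 μ).flip k) := by
  induction k using Lp.induction (p := 2) ENNReal.ofNat_ne_top with
  | @indicatorConst c s hs hμs =>
    have h1 : IsCompactOperator (B.flip c) := by
      have := (isCompactOperator_of_locallyCompactSpace_dom
        (ContinuousLinearMap.id ℝ ℝ)).comp_clm (B.flip c)
      exact this
    have h2 := h1.clm_comp (ContinuousLinearMap.toSpanSingleton ℝ
      (indicatorConstLp 2 hs hμs.ne (1 : ℝ)))
    convert! h2 using 1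
    ext1 u
    simp only [Function.comp, ContinuousLinearMap.toSpanSingleton_apply,
      ContinuousLinearMap.flip_apply, ContinuousLinearMap.compLpL₂_apply_apply,
      Lp.simpleFunc.coe_indicatorConst]
    refine Lp.ext ?_
    filter_upwards [ContinuousLinearMap.coeFn_compLp (B u) (indicatorConstLp 2 hs hμs.ne c),
      indicatorConstLp_coeFn (p := 2) (hs := hs) (hμs := hμs.ne) (c := c),
      indicatorConstLp_coeFn (p := 2) (hs := hs) (hμs := hμs.ne) (c := (1 : ℝ)),
      Lp.coeFn_smul (B u c) (indicatorConstLp 2 hs hμs.ne (1 : ℝ))] with x h1 h2 h3 h4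
    rw [h1, h2, h4, Pi.smul_apply, h3]
    by_cases hx : x ∈ s <;> simp [hx]
  | add hf hg _ h1 h2 =>
    rw [map_add]
    exact h1.add h2
  | isClosed =>
    exact isClosed_setOfPred_isCompactOperator.preimage (B.compLpL₂ 2 μ).flip.continuous

/-- The real inner product as a continuous bilinear form. -/
def realInnerL (H : Type*) [NormedAddCommGroup H] [InnerProductSpace ℝ H] : H →L[ℝ] H →L[ℝ] ℝ :=
  (innerₗ H).mkContinuous₂ 1 fun x y => by simpa using! norm_inner_le_norm (𝕜 := ℝ) x y

/-! ### The inverse of the degenerate operator -/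

theorem continuous_segment : Continuous segment := by
  refine continuous_indicatorConstLp_set (by norm_num) fun x => ?_
  have h0 : Filter.Tendsto (fun y : ℝ => ENNReal.ofReal |y - x|) (nhds x) (nhds 0) := by
    have : Continuous fun y : ℝ => ENNReal.ofReal |y - x| :=
      ENNReal.continuous_ofReal.comp (by fun_prop)
    simpa using this.tendsto x
  refine tendsto_of_tendsto_of_tendsto_of_le_of_le tendsto_const_nhds h0 (fun _ => zero_le)
    fun y => ?_
  have hsub : symmDiff (uIoc 0 y) (uIoc 0 x) ⊆ uIoc x y := by
    intro t ht
    rw [mem_symmDiff, mem_uIoc, mem_uIoc] at ht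
    rw [mem_uIoc]
    grind
  calc vol (symmDiff (uIoc 0 y) (uIoc 0 x)) ≤ volume (uIoc x y) :=
        (Measure.restrict_apply_le _ _).trans (measure_mono hsub)
    _ = _ := by rw [Real.volume_uIoc]

/-- The kernel of the weighted Volterra operator `volterra`, as a function with values in
`L²(-1,1)`. -/
def volterraKernel (α s : ℝ) : X := |s| ^ (-α / 2) • segment s

theorem integrableOn_abs_rpow {r : ℝ} (hr : -1 < r) :
    IntegrableOn (fun x : ℝ => |x| ^ r) Omega := by
  have h1 : IntegrableOn (fun x : ℝ => |x| ^ r) (Ioo 0 1) := by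
    refine ((intervalIntegral.integrableOn_Ioo_rpow_iff one_pos).2 hr).congr_fun
      (fun x hx => ?_) measurableSet_Ioo
    simp only [abs_of_pos hx.1]
  have h2 : IntegrableOn (fun x : ℝ => |x| ^ r) (Ioo (-1) 0) := by
    have e : Ioo (-1 : ℝ) 0 = Neg.neg ⁻¹' Ioo (0 : ℝ) 1 := by
      ext x
      simp only [mem_preimage, mem_Ioo]
      constructor <;> rintro ⟨h1, h2⟩ <;> constructor <;> linarith
    have := ((Measure.measurePreserving_neg (volume : Measure ℝ)).integrableOn_comp_preimage
      (Homeomorph.neg ℝ).measurableEmbedding).2 h1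
    rw [e]
    refine this.congr_fun (fun x _ => ?_) (by rw [← e]; exact measurableSet_Ioo)
    simp
  have h3 : IntegrableOn (fun x : ℝ => |x| ^ r) {0} := by simp
  refine (h2.union (h3.union h1)).mono_set fun x hx => ?_
  rcases lt_trichotomy x 0 with h | h | h
  · exact .inl ⟨hx.1, h⟩
  · exact .inr (.inl h)
  · exact .inr (.inr ⟨h, hx.2⟩)

theorem memLp_volterraKernel {α : ℝ} (hα2 : α < 2) : MemLp (volterraKernel α) 2 vol := by
  have hm : AEStronglyMeasurable (volterraKernel α) vol := by
    have : Measurable fun s : ℝ => |s| ^ (-α / 2) := by fun_prop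
    exact this.aestronglyMeasurable.smul continuous_segment.aestronglyMeasurable
  rw [memLp_two_iff_integrable_sq_norm hm]
  refine (integrableOn_abs_rpow (r := 1 - α) (by linarith)).congr ?_
  filter_upwards [ae_restrict_mem measurableSet_Ioo, ae_restrict_of_ae (Measure.ae_ne volume 0)]
    with s hs hs0
  have h0 := abs_pos.2 hs0
  rw [volterraKernel, norm_smul, norm_segment hs, mul_pow, Real.sq_sqrt h0.le,
    Real.norm_of_nonneg (Real.rpow_nonneg h0.le _), ← Real.rpow_natCast, ← Real.rpow_mul h0.le,
    ← Real.rpow_add_one h0.ne']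
  congr 1
  push_cast
  ring

/-- The operator `V u (s) = |s|^(-α/2) ∫ u`, the integral being over the unoriented segment between
`0` and `s`. The inverse of `u ↦ -(|x|^α u')'` is `V* V`. -/
def volterra (α : ℝ) (hα2 : α < 2) : X →L[ℝ] X :=
  ((realInnerL X).compLpL₂ 2 vol).flip (memLp_volterraKernel hα2).toLp

theorem isCompactOperator_volterra {α : ℝ} (hα2 : α < 2) : IsCompactOperator (volterra α hα2) :=
  isCompactOperator_compLpL₂_flip _ _

theorem volterra_coeFn {α : ℝ} (hα2 : α < 2) (u : X) :
    volterra α hα2 u =ᵐ[vol] fun s => |s| ^ (-α / 2) * ∫ x in uIoc 0 s, u x := by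
  have h := ContinuousLinearMap.coeFn_compLp (realInnerL X u) (memLp_volterraKernel hα2).toLp
  filter_upwards [h, (memLp_volterraKernel hα2).coeFn_toLp, ae_restrict_mem measurableSet_Ioo]
    with s h1 h2 hs
  rw [volterra, ContinuousLinearMap.flip_apply, ContinuousLinearMap.compLpL₂_apply_apply, h1, h2]
  change inner ℝ u (volterraKernel α s) = _
  rw [real_inner_comm, volterraKernel, real_inner_smul_left, inner_segment hs]

theorem inner_volterra {α : ℝ} (hα2 : α < 2) (u w : X) :
    inner ℝ (volterra α hα2 u) (volterra α hα2 w) =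
      ∫ s in Omega, |s| ^ (-α) * (∫ t in (0 : ℝ)..s, u t) * ∫ t in (0 : ℝ)..s, w t := by
  rw [L2.inner_def]
  refine integral_congr_ae ?_
  filter_upwards [volterra_coeFn hα2 u, volterra_coeFn hα2 w,
    ae_restrict_of_ae (Measure.ae_ne volume 0)] with s h1 h2 hs
  have e : |s| ^ (-α) = |s| ^ (-α / 2) * |s| ^ (-α / 2) := by
    rw [← Real.rpow_add (abs_pos.2 hs)]
    ring_nf
  rw [h1, h2, intervalIntegral.intervalIntegral_eq_integral_uIoc,
    intervalIntegral.intervalIntegral_eq_integral_uIoc, e]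
  simp only [smul_eq_mul, RCLike.inner_apply, conj_trivial]
  split_ifs <;> ring

/-- The inverse of `u ↦ -(|x|^α u')'`, a compact self-adjoint operator on `L²(-1,1)`. -/
def inverseOp (α : ℝ) (hα2 : α < 2) : X →L[ℝ] X :=
  (volterra α hα2).adjoint ∘L volterra α hα2

theorem isCompactOperator_inverseOp {α : ℝ} (hα2 : α < 2) :
    IsCompactOperator (inverseOp α hα2) :=
  (isCompactOperator_volterra hα2).clm_comp (volterra α hα2).adjoint

theorem inner_inverseOp {α : ℝ} (hα2 : α < 2) (u w : X) :
    inner ℝ (inverseOp α hα2 u) w = inner ℝ (volterra α hα2 u) (volterra α hα2 w) := by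
  rw [inverseOp, ContinuousLinearMap.comp_apply, ContinuousLinearMap.adjoint_inner_left]

theorem isSymmetric_inverseOp {α : ℝ} (hα2 : α < 2) : (inverseOp α hα2).IsSymmetric := by
  intro u w
  change inner ℝ (inverseOp α hα2 u) w = inner ℝ u (inverseOp α hα2 w)
  rw [real_inner_comm (inverseOp α hα2 w), inner_inverseOp, inner_inverseOp, real_inner_comm]

theorem eq_zero_of_inverseOp_eq_zero {α : ℝ} (hα2 : α < 2) {u : X}
    (hu : inverseOp α hα2 u = 0) : u = 0 := by
  have h1 : volterra α hα2 u = 0 := by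
    rw [← inner_self_eq_zero (𝕜 := ℝ), ← inner_inverseOp, hu, inner_zero_left]
  have h2 : ∀ᵐ s ∂vol, ∫ t in (0 : ℝ)..s, u t = 0 := by
    filter_upwards [volterra_coeFn hα2 u, Lp.coeFn_zero ℝ 2 vol,
      ae_restrict_of_ae (Measure.ae_ne volume 0)] with s h3 h4 hs
    rw [h1, h4, Pi.zero_apply, eq_comm, mul_eq_zero] at h3
    have := h3.resolve_left (Real.rpow_pos_of_pos (abs_pos.2 hs) _).ne'
    rw [intervalIntegral.intervalIntegral_eq_integral_uIoc, this, smul_zero]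
  have hL2 := Lp.memLp u
  have key := isOpen_Ioo.ae_eq_zero_of_integral_contDiff_smul_eq_zero (μ := volume) (U := Omega)
    (integrableOn_of_memLp hL2).locallyIntegrableOn fun φ φs φc φt => by
      have h3 := weakDeriv_primitive hL2 φs φt
      rw [integral_congr_ae (g := fun _ => 0)
        (by filter_upwards [h2] with s hs; rw [hs, zero_mul])] at h3
      rw [← setIntegral_eq_integral_of_forall_compl_eq_zero (s := Omega)]
      · simp only [smul_eq_mul, mul_comm (φ _)]
        simpa using h3
      · exact fun x hx => by rw [image_eq_zero_of_notMem_tsupport fun h' => hx (φt h'), zero_smul]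
  refine Lp.ext ?_
  have := (ae_restrict_iff' measurableSet_Ioo).2 key
  filter_upwards [this, Lp.coeFn_zero ℝ 2 vol] with x h3 h4
  rw [h3, h4, Pi.zero_apply]

theorem continuous_mul_of_eq_zero_near_zero {f g : ℝ → ℝ} (hf : ContinuousOn f {0}ᶜ)
    (hg : Continuous g) {δ : ℝ} (hδ : 0 < δ) (h : ∀ x, |x| < δ → g x = 0) :
    Continuous fun x => f x * g x := by
  refine continuous_iff_continuousAt.2 fun x => ?_
  rcases eq_or_ne x 0 with rfl | hx
  · refine (continuousAt_const (y := (0 : ℝ))).congr ?_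
    filter_upwards [Metric.ball_mem_nhds (0 : ℝ) hδ] with y hy
    rw [h y (by simpa using hy), mul_zero]
  · exact (hf.continuousAt (isOpen_compl_singleton.mem_nhds hx)).mul hg.continuousAt

/-- An eigenfunction of the inverse operator solves the integrated eigenvalue problem. The relation
`⟪V u, V w⟫ = μ ⟪u, w⟫` is tested with `w` supported away from `0` and integrated by parts, which
avoids computing the kernel of `V* V`. -/
theorem exists_integralSolution {α μ : ℝ} (hα2 : α < 2) (hμ : μ ≠ 0) {u : X}
    (hu : inverseOp α hα2 u = μ • u) :
    ∃ v : ℝ → ℝ, u =ᵐ[vol] v ∧ IntegralSolution α μ⁻¹ v := by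
  have hL2 := Lp.memLp u
  set U : ℝ → ℝ := fun s => ∫ t in (0 : ℝ)..s, u t with hU
  set p : ℝ → ℝ := fun s => max (-1) (min s 1) with hp
  have hpI {s : ℝ} (h1 : -1 ≤ s) (h2 : s ≤ 1) : p s = s := by simp [hp, h1, h2]
  -- `U` extended by constants beyond `±1`
  have cU : Continuous fun s => U (p s) := by
    refine (continuousOn_primitive hL2).comp_continuous (by fun_prop) fun s => ?_
    exact ⟨le_max_left _ _, max_le (by norm_num) (min_le_right _ _)⟩
  set h : ℝ → ℝ := fun s => |s| ^ (-α) * U (p s) with hh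
  have ch : ContinuousOn h {0}ᶜ :=
    (continuous_abs.continuousOn.rpow_const fun t ht => .inl (abs_ne_zero.2 ht)).mul
      cU.continuousOn
  set v : ℝ → ℝ := fun x => if 0 < x then -μ⁻¹ * ∫ s in (1 : ℝ)..x, h s
    else -μ⁻¹ * ∫ s in (-1 : ℝ)..x, h s with hv
  have ftc {a x : ℝ} (ha : a ≠ 0) (hax : 0 < a * x) :
      HasDerivAt (fun y => ∫ s in a..y, h s) (h x) x := by
    have hx : x ≠ 0 := right_ne_zero_of_mul hax.ne'
    refine intervalIntegral.integral_hasDerivAt_right (ch.mono ?_).intervalIntegrable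
      (ch.stronglyMeasurableAtFilter isOpen_compl_singleton x hx)
      (ch.continuousAt (isOpen_compl_singleton.mem_nhds hx))
    rintro y hy (rfl : y = 0)
    rw [mem_uIcc] at hy
    rcases hy with hy | hy <;> nlinarith
  have dv {x : ℝ} (hx : x ≠ 0) : HasDerivAt v (-μ⁻¹ * h x) x := by
    rcases lt_or_gt_of_ne hx with h0 | h0
    · refine ((ftc (a := -1) (by norm_num) (by linarith)).const_mul (-μ⁻¹)).congr_of_eventuallyEq ?_
      filter_upwards [gt_mem_nhds h0] with y hy
      simp only [hv, if_neg (not_lt.2 (le_of_lt hy))]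
    · refine ((ftc (a := 1) (by norm_num) (by linarith)).const_mul (-μ⁻¹)).congr_of_eventuallyEq ?_
      filter_upwards [lt_mem_nhds h0] with y hy
      simp only [hv, if_pos hy]
  have cv : ContinuousOn v {0}ᶜ := fun x hx => (dv hx).continuousAt.continuousWithinAt
  have v1 : v 1 = 0 := by simp [hv]
  have v2 : v (-1) = 0 := by
    simp only [hv]
    rw [if_neg (by norm_num)]
    simp
  -- `u = v` is tested with functions supported away from `0`
  have huv : ∀ᵐ x, x ∈ Omega \ {0} → u x - v x = 0 := by
    refine (isOpen_Ioo.sdiff isClosed_singleton).ae_eq_zero_of_integral_contDiff_smul_eq_zero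
      (f := fun x => u x - v x)
      (((integrableOn_of_memLp hL2).mono_set sdiff_subset).locallyIntegrableOn.sub
        ((cv.mono fun x hx => hx.2).locallyIntegrableOn
          (measurableSet_Ioo.diff (measurableSet_singleton 0)))) fun g gs gc gt => ?_
    have gz : ∀ x ∉ Omega, g x = 0 := fun x hx =>
      image_eq_zero_of_notMem_tsupport fun h' => hx (gt h').1
    obtain ⟨δ, hδ, hball⟩ : ∃ δ > 0, ∀ x, |x| < δ → g x = 0 := by
      have h0 : (tsupport g)ᶜ ∈ nhds (0 : ℝ) :=
        (isClosed_tsupport g).isOpen_compl.mem_nhds fun h' => (gt h').2 rfl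
      obtain ⟨δ, hδ, hb⟩ := Metric.mem_nhds_iff.1 h0
      exact ⟨δ, hδ, fun x hx => image_eq_zero_of_notMem_tsupport (hb (by simpa using hx))⟩
    set W : ℝ → ℝ := fun x => ∫ t in (0 : ℝ)..x, g t with hW
    have dW (x : ℝ) : HasDerivAt W (g x) x :=
      intervalIntegral.integral_hasDerivAt_right (gs.continuous.intervalIntegrable _ _)
        (gs.continuous.stronglyMeasurableAtFilter _ _) gs.continuous.continuousAt
    have cW : Continuous W := continuous_iff_continuousAt.2 fun x => (dW x).continuousAt
    have hW0 : ∀ x, |x| < δ → W x = 0 := by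
      intro x hx
      refine (intervalIntegral.integral_congr fun t ht => hball t ?_).trans
        intervalIntegral.integral_zero
      rw [mem_uIcc] at ht
      rw [abs_lt] at hx ⊢
      constructor <;> rcases ht with ht | ht <;> linarith [ht.1, ht.2]
    have c1 := continuous_mul_of_eq_zero_near_zero cv gs.continuous hδ hball
    have c2 := continuous_mul_of_eq_zero_near_zero ch cW hδ hW0
    have c3 := continuous_mul_of_eq_zero_near_zero cv cW hδ hW0
    have key := MeasureTheory.integral_eq_of_hasDerivAt_off_countable (a := -1) (b := 1)
      (s := {0}) (fun x => v x * W x) (fun x => v x * g x + -μ⁻¹ * (h x * W x))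
      (countable_singleton 0) c3.continuousOn
      (fun x hx => ((dv hx.2).mul (dW x)).congr_deriv (by ring))
      ((c1.add (c2.const_mul _)).intervalIntegrable _ _)
    rw [intervalIntegral.integral_add (c1.intervalIntegrable _ _)
      ((c2.const_mul _).intervalIntegrable _ _), intervalIntegral.integral_const_mul, v1, v2,
      ← integral_Omega_eq, ← integral_Omega_eq] at key
    have hgL : MemLp g 2 vol := (gs.continuous.memLp_of_hasCompactSupport gc).restrict _
    have e1 : inner ℝ (inverseOp α hα2 u) (hgL.toLp g) = ∫ x in Omega, h x * W x := by
      rw [inner_inverseOp, inner_volterra]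
      refine integral_congr_ae ?_
      filter_upwards [ae_restrict_mem measurableSet_Ioo] with s hs
      have e2 : ∫ t in (0 : ℝ)..s, hgL.toLp g t = W s := by
        refine intervalIntegral.integral_congr_ae ?_
        filter_upwards [(ae_restrict_iff' measurableSet_Ioo).1 hgL.coeFn_toLp] with t ht hts
        exact ht (uIoc_zero_subset_Omega hs hts)
      rw [e2]
      simp only [hh, hpI hs.1.le hs.2.le, hU]
    have e3 : inner ℝ (inverseOp α hα2 u) (hgL.toLp g) = μ * ∫ x in Omega, u x * g x := by
      rw [hu, real_inner_smul_left, L2.inner_def]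
      congr 1
      refine integral_congr_ae ?_
      filter_upwards [hgL.coeFn_toLp] with x hx
      rw [hx]
      simp [mul_comm]
    have i1 : IntegrableOn (fun x => u x * g x) Omega :=
      integrable_mul_test (integrableOn_of_memLp hL2).locallyIntegrableOn gs.continuous gc
        fun x hx => (gt hx).1
    rw [← setIntegral_eq_integral_of_forall_compl_eq_zero (s := Omega)
      fun x hx => by rw [gz x hx, zero_smul]]
    have e4 : ∫ x in Omega, g x • (u x - v x) =
        (∫ x in Omega, u x * g x) - ∫ x in Omega, v x * g x := by
      rw [← integral_sub i1 (integrable_vol_of_continuous c1)]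
      refine integral_congr_ae (.of_forall fun x => ?_)
      simp only [smul_eq_mul]
      ring
    rw [e4]
    rw [← e1, e3] at key
    field_simp at key
    linarith
  have hae : u =ᵐ[vol] v := by
    rw [Filter.EventuallyEq, ae_restrict_iff' measurableSet_Ioo]
    filter_upwards [huv, Measure.ae_ne volume 0] with x hx hx0 hxm
    exact sub_eq_zero.1 (hx ⟨hxm, hx0⟩)
  refine ⟨v, hae, (memLp_congr_ae hae).1 hL2, fun x hx => ?_, fun x hx => ?_⟩
  all_goals
    have hhv {s : ℝ} (hs : s ∈ Omega) : h s = |s| ^ (-α) * ∫ t in (0 : ℝ)..s, v t := by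
      simp only [hh, hpI hs.1.le hs.2.le, hU]
      congr 1
      refine intervalIntegral.integral_congr_ae ?_
      filter_upwards [(ae_restrict_iff' measurableSet_Ioo).1 hae] with t ht hts
      exact ht (uIoc_zero_subset_Omega hs hts)
  · simp only [hv, if_pos hx.1]
    rw [intervalIntegral.integral_symm x 1, neg_mul_neg]
    congr 1
    refine intervalIntegral.integral_congr_uIoo fun s hs => ?_
    rw [uIoo_of_lt hx.2] at hs
    exact hhv ⟨by linarith [hx.1, hs.1], hs.2⟩
  · rw [← neg_mul]
    conv_lhs => simp only [hv, if_neg hx.2.not_gt]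
    congr 1
    refine intervalIntegral.integral_congr_uIoo fun s hs => ?_
    rw [uIoo_of_lt hx.1] at hs
    exact hhv ⟨hs.1, by linarith [hx.2, hs.2]⟩

/-! ### Two-sided radial functions in `L²(-1,1)` -/

/-- The class of `twoSided α β a b` in `L²(-1,1)`. -/
def twoSidedLp (α : ℝ) (hα1 : 1 ≤ α) (hα2 : α < 2) (β a b : ℝ) : X :=
  (memLp_twoSided hα1 hα2 β a b).toLp

theorem integral_twoSided_mul_twoSided {α : ℝ} (hα1 : 1 ≤ α) (hα2 : α < 2) (β γ a b c d : ℝ) :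
    ∫ x in Omega, twoSided α β a b x * twoSided α γ c d x =
      (a * c + b * d) * ∫ x in (0 : ℝ)..1, radial α β x * radial α γ x := by
  have hi : IntegrableOn (fun x => twoSided α β a b x * twoSided α γ c d x) Omega :=
    (memLp_twoSided hα1 hα2 β a b).integrable_mul (memLp_twoSided hα1 hα2 γ c d)
  have hi' : IntervalIntegrable (fun x => twoSided α β a b x * twoSided α γ c d x) volume (-1) 1 :=
    (intervalIntegrable_iff_integrableOn_Ioo_of_le (by norm_num)).2 hi
  rw [integral_Omega_eq, ← intervalIntegral.integral_add_adjacent_intervals (b := 0)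
    (hi'.mono_set (by simp [uIcc_of_le, Icc_subset_Icc])) (hi'.mono_set (by
      simp [uIcc_of_le, Icc_subset_Icc]))]
  have e1 : ∫ x in (0 : ℝ)..1, twoSided α β a b x * twoSided α γ c d x =
      a * c * ∫ x in (0 : ℝ)..1, radial α β x * radial α γ x := by
    rw [← intervalIntegral.integral_const_mul]
    refine intervalIntegral.integral_congr_uIoo fun x hx => ?_
    rw [uIoo_of_lt one_pos] at hx
    simp only [twoSided, if_pos hx.1]
    ring
  have e2 : ∫ x in (-1 : ℝ)..0, twoSided α β a b x * twoSided α γ c d x =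
      b * d * ∫ x in (0 : ℝ)..1, radial α β x * radial α γ x := by
    have := intervalIntegral.integral_comp_neg (a := -1) (b := 0)
      fun x => radial α β x * radial α γ x
    simp only [radial_neg, neg_zero, neg_neg] at this
    rw [← this, ← intervalIntegral.integral_const_mul]
    refine intervalIntegral.integral_congr_uIoo fun x hx => ?_
    rw [uIoo_of_lt (by norm_num)] at hx
    simp only [twoSided, if_neg hx.2.not_gt, if_pos hx.2]
    ring
  rw [e1, e2]
  ring

theorem inner_twoSidedLp {α : ℝ} (hα1 : 1 ≤ α) (hα2 : α < 2) (β γ a b c d : ℝ) :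
    inner ℝ (twoSidedLp α hα1 hα2 β a b) (twoSidedLp α hα1 hα2 γ c d) =
      (a * c + b * d) * ∫ x in (0 : ℝ)..1, radial α β x * radial α γ x := by
  rw [← integral_twoSided_mul_twoSided hα1 hα2, L2.inner_def]
  refine integral_congr_ae ?_
  filter_upwards [(memLp_twoSided hα1 hα2 β a b).coeFn_toLp,
    (memLp_twoSided hα1 hα2 γ c d).coeFn_toLp] with x h1 h2
  simp only [twoSidedLp, h1, h2]
  simp [mul_comm]

theorem twoSidedLp_eq {α : ℝ} (hα1 : 1 ≤ α) (hα2 : α < 2) (β a b : ℝ) : twoSidedLp α hα1 hα2 β a b =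
    a • twoSidedLp α hα1 hα2 β 1 0 + b • twoSidedLp α hα1 hα2 β 0 1 := by
  refine Lp.ext ?_
  filter_upwards [(memLp_twoSided hα1 hα2 β a b).coeFn_toLp,
    (memLp_twoSided hα1 hα2 β 1 0).coeFn_toLp, (memLp_twoSided hα1 hα2 β 0 1).coeFn_toLp,
    Lp.coeFn_add (a • twoSidedLp α hα1 hα2 β 1 0) (b • twoSidedLp α hα1 hα2 β 0 1),
    Lp.coeFn_smul a (twoSidedLp α hα1 hα2 β 1 0),
    Lp.coeFn_smul b (twoSidedLp α hα1 hα2 β 0 1)] with x h1 h2 h3 h4 h5 h6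
  rw [h4, Pi.add_apply, h5, h6, Pi.smul_apply, Pi.smul_apply, twoSidedLp, twoSidedLp, twoSidedLp,
    h1, h2, h3]
  simp only [twoSided, smul_eq_mul]
  split_ifs <;> ring

theorem eq_twoSidedLp {α : ℝ} (hα1 : 1 ≤ α) (hα2 : α < 2)
    {β : ℝ} {u : X} {v : ℝ → ℝ} (huv : u =ᵐ[vol] v)
    (hv : IntegralSolution α (β * (2 - α) ^ 2) v) :
    ∃ a b, u = twoSidedLp α hα1 hα2 β a b ∧ (besselSeries (nu α) β ≠ 0 → a = 0 ∧ b = 0) := by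
  obtain ⟨a, b, h, h0⟩ := hv.eq_twoSided hα1 hα2
  refine ⟨a, b, Lp.ext ?_, h0⟩
  filter_upwards [huv, (memLp_twoSided hα1 hα2 β a b).coeFn_toLp,
    ae_restrict_of_ae (Measure.ae_ne volume 0), ae_restrict_mem measurableSet_Ioo]
    with x h1 h2 h3 h4
  rw [h1, h x h4 h3, twoSidedLp, h2]

theorem twoSidedLp_mem_eigenspace {α : ℝ} (hα1 : 1 ≤ α) (hα2 : α < 2)
    {β : ℝ} (hβ : besselSeries (nu α) β = 0) (a b : ℝ) :
    twoSidedLp α hα1 hα2 β a b ∈ eigenspace α (β * (2 - α) ^ 2) :=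
  ⟨_, (memLp_twoSided hα1 hα2 β a b).coeFn_toLp, solves_twoSided hα1 hα2 hβ a b⟩

theorem exists_of_mem_eigenspace {α : ℝ} (hα1 : 1 ≤ α) (hα2 : α < 2)
    {lam : ℝ} {u : X} (hu : u ∈ eigenspace α lam) :
    ∃ a b, u = twoSidedLp α hα1 hα2 (lam / (2 - α) ^ 2) a b ∧
      (besselSeries (nu α) (lam / (2 - α) ^ 2) ≠ 0 → a = 0 ∧ b = 0) := by
  obtain ⟨v, huv, hv⟩ := hu
  have h2 : (2 - α) ^ 2 ≠ 0 := pow_ne_zero _ (by linarith)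
  refine eq_twoSidedLp hα1 hα2 huv ?_
  rw [div_mul_cancel₀ _ h2]
  exact hv.integralSolution hα1

theorem twoSidedLp_zero {α : ℝ} (hα1 : 1 ≤ α) (hα2 : α < 2)
    (β : ℝ) : twoSidedLp α hα1 hα2 β 0 0 = 0 := by
  rw [twoSidedLp_eq, zero_smul, zero_smul, add_zero]

/-- The span of the eigenfunctions. -/
def eigenSpan {α : ℝ} (hα1 : 1 ≤ α) (hα2 : α < 2) : Submodule ℝ X :=
  Submodule.span ℝ (⋃ β ∈ {β : ℝ | besselSeries (nu α) β = 0},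
    {twoSidedLp α hα1 hα2 β 1 0, twoSidedLp α hα1 hα2 β 0 1})

theorem twoSidedLp_mem_eigenSpan {α : ℝ} (hα1 : 1 ≤ α) (hα2 : α < 2)
    {β : ℝ} (hβ : besselSeries (nu α) β = 0) (a b : ℝ) :
    twoSidedLp α hα1 hα2 β a b ∈ eigenSpan hα1 hα2 := by
  rw [twoSidedLp_eq]
  refine add_mem (Submodule.smul_mem _ _ (Submodule.subset_span ?_))
    (Submodule.smul_mem _ _ (Submodule.subset_span ?_)) <;>
  exact mem_biUnion (show β ∈ {β : ℝ | besselSeries (nu α) β = 0} from hβ) (by simp)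

/-- Completeness of the eigenfunctions, from the spectral theorem for the inverse operator. -/
theorem eigenSpan_orthogonal {α : ℝ} (hα1 : 1 ≤ α) (hα2 : α < 2) : (eigenSpan hα1 hα2)ᗮ = ⊥ := by
  rw [eq_bot_iff, ← ContinuousLinearMap.orthogonalComplement_iSup_eigenspaces_eq_bot
    (isCompactOperator_inverseOp hα2) (isSymmetric_inverseOp hα2)]
  refine Submodule.orthogonal_le (iSup_le fun μ u hu => ?_)
  have hu' : inverseOp α hα2 u = μ • u := Module.End.mem_eigenspace_iff.1 hu
  rcases eq_or_ne μ 0 with rfl | hμ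
  · rw [zero_smul] at hu'
    rw [eq_zero_of_inverseOp_eq_zero hα2 hu']
    exact zero_mem _
  · obtain ⟨v, huv, hv⟩ := exists_integralSolution hα2 hμ hu'
    have h2 : (2 - α) ^ 2 ≠ 0 := pow_ne_zero _ (by linarith)
    rw [← div_mul_cancel₀ μ⁻¹ h2] at hv
    obtain ⟨a, b, rfl, hab⟩ := eq_twoSidedLp hα1 hα2 huv hv
    by_cases hβ : besselSeries (nu α) (μ⁻¹ / (2 - α) ^ 2) = 0
    · exact twoSidedLp_mem_eigenSpan hα1 hα2 hβ a b
    · obtain ⟨rfl, rfl⟩ := hab hβ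
      rw [twoSidedLp_zero]
      exact zero_mem _

/-! ### The zeros of the Bessel function -/

theorem not_finiteDimensional_L2 : ¬ FiniteDimensional ℝ X := by
  intro hfin
  set s : ℕ → Set ℝ := fun n => Ioo (1 / ((n : ℝ) + 2)) (1 / ((n : ℝ) + 1)) with hs
  have hsub (n : ℕ) : s n ⊆ Omega := fun x hx => by
    have h1 : 0 < 1 / ((n : ℝ) + 2) := by positivity
    have h2 : 1 / ((n : ℝ) + 1) ≤ 1 := by
      rw [div_le_one (by positivity)]
      linarith [n.cast_nonneg (α := ℝ)]
    exact ⟨by linarith [hx.1], hx.2.trans_le h2⟩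
  have hm (n : ℕ) : MeasurableSet (s n) := measurableSet_Ioo
  have hdisj {m n : ℕ} (hmn : m < n) : Disjoint (s m) (s n) := by
    rw [Set.disjoint_left]
    intro x h1 h2
    have h3 : 1 / ((n : ℝ) + 1) ≤ 1 / ((m : ℝ) + 2) := by
      have : (m : ℝ) + 1 ≤ n := by exact_mod_cast hmn
      exact one_div_le_one_div_of_le (by positivity) (by linarith)
    exact lt_irrefl x (h2.2.trans (h3.trans_lt h1.1))
  set e : ℕ → X := fun n => indicatorConstLp 2 (hm n) (measure_ne_top vol _) (1 : ℝ)
  have hin (m n : ℕ) : inner ℝ (e m) (e n) = volume.real (s m ∩ s n) := by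
    rw [L2.inner_indicatorConstLp_one, setIntegral_indicatorConstLp (hm m),
      measureReal_restrict_apply ((hm n).inter (hm m)), inter_eq_left.2
        (inter_subset_left.trans (hsub n)), inter_comm]
    simp
  have hli : LinearIndependent ℝ e := by
    refine linearIndependent_of_ne_zero_of_inner_eq_zero (𝕜 := ℝ) (fun n h => ?_) fun m n hmn => ?_
    · have h1 := hin n n
      rw [h, inner_zero_left, inter_self, hs] at h1
      have h2 : 1 / ((n : ℝ) + 2) < 1 / ((n : ℝ) + 1) := by
        gcongr
        norm_num
      rw [measureReal_def, Real.volume_Ioo, ENNReal.toReal_ofReal (by linarith)] at h1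
      linarith
    · have h1 := hin m n
      rcases lt_or_gt_of_ne hmn with h | h
      · rw [(hdisj h).inter_eq] at h1
        simpa using! h1
      · rw [(hdisj h).symm.inter_eq] at h1
        simpa using! h1
  have := hli.finite
  exact not_finite ℕ

/-- The Bessel series has infinitely many zeros, since its zeros provide a complete system in an
infinite dimensional space. -/
theorem infinite_zeros_besselSeries {α : ℝ} (hα1 : 1 ≤ α) (hα2 : α < 2) :
    {β : ℝ | besselSeries (nu α) β = 0}.Infinite := by
  intro hfin
  have : FiniteDimensional ℝ (eigenSpan hα1 hα2) :=
    FiniteDimensional.span_of_finite ℝ (hfin.biUnion fun β _ => by simp)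
  have htop : eigenSpan hα1 hα2 = ⊤ :=
    Submodule.orthogonal_eq_bot_iff.1 (eigenSpan_orthogonal hα1 hα2)
  rw [htop] at this
  exact not_finiteDimensional_L2 (LinearEquiv.finiteDimensional Submodule.topEquiv)

theorem pos_of_besselSeries_eq_zero {α : ℝ} (hα1 : 1 ≤ α) (hα2 : α < 2)
    {β : ℝ} (hβ : besselSeries (nu α) β = 0) : 0 < β := by
  by_contra h
  exact (besselSeries_pos_of_nonpos (nu_nonneg hα1 hα2) (not_lt.1 h)).ne' hβ

/-- An accumulation point of zeros would be a multiple zero. -/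
theorem finite_zeros_besselSeries_le {α : ℝ} (hα1 : 1 ≤ α) (hα2 : α < 2) (R : ℝ) :
    ({β : ℝ | besselSeries (nu α) β = 0} ∩ Iic R).Finite := by
  by_contra hinf
  have hsub : {β : ℝ | besselSeries (nu α) β = 0} ∩ Iic R ⊆ Icc 0 R := fun β hβ =>
    ⟨(pos_of_besselSeries_eq_zero hα1 hα2 hβ.1).le, hβ.2⟩
  obtain ⟨x, -, hx⟩ := Set.Infinite.exists_accPt_of_subset_isCompact hinf isCompact_Icc hsub
  have hν := nu_nonneg hα1 hα2
  have hne : ∀ᶠ z in nhdsWithin x {x}ᶜ, besselSeries (nu α) z ≠ 0 := by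
    by_cases h0 : besselSeries (nu α) x = 0
    · exact (hasDerivAt_besselSeries hν x).eventually_ne
        (neg_ne_zero.2 (besselSeries_add_one_ne_zero hα1 hα2 h0))
    · exact ((continuous_besselSeries hν).continuousAt.eventually_ne h0).filter_mono
        nhdsWithin_le_nhds
  rw [accPt_iff_frequently_nhdsNE] at hx
  obtain ⟨z, hz, hz'⟩ := (hx.and_eventually hne).exists
  exact hz' hz.1

theorem quarter_sq_injOn : InjOn (fun y : ℝ => y ^ 2 / 4) (Ioi 0) := by
  intro x hx y hy h
  have hx : (0 : ℝ) < x := hx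
  have hy : (0 : ℝ) < y := hy
  have : x ^ 2 = y ^ 2 := by linarith
  exact (pow_left_inj₀ hx.le hy.le two_ne_zero).1 this

theorem finite_zeros_besselJ_le {α : ℝ} (hα1 : 1 ≤ α) (hα2 : α < 2)
    (R : ℝ) : {y : ℝ | (0 < y ∧ besselJ (nu α) y = 0) ∧ y ≤ R}.Finite := by
  refine Set.Finite.of_finite_image (f := fun y : ℝ => y ^ 2 / 4)
    ((finite_zeros_besselSeries_le hα1 hα2 (R ^ 2 / 4)).subset ?_)
    (quarter_sq_injOn.mono fun y hy => hy.1.1)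
  rintro - ⟨y, ⟨⟨hy, h0⟩, hR⟩, rfl⟩
  refine ⟨(besselJ_eq_zero_iff hy).1 h0, ?_⟩
  simp only [mem_Iic]
  gcongr

theorem infinite_zeros_besselJ {α : ℝ} (hα1 : 1 ≤ α) (hα2 : α < 2) :
    {y : ℝ | 0 < y ∧ besselJ (nu α) y = 0}.Infinite := by
  intro hfin
  refine infinite_zeros_besselSeries hα1 hα2 ((hfin.image fun y => y ^ 2 / 4).subset ?_)
  intro β hβ
  have hβ0 := pos_of_besselSeries_eq_zero hα1 hα2 hβ
  have e : (2 * √β) ^ 2 / 4 = β := by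
    rw [mul_pow, Real.sq_sqrt hβ0.le]
    ring
  have hy : 0 < 2 * √β := by positivity
  refine ⟨2 * √β, ⟨hy, ?_⟩, e⟩
  rw [besselJ_eq_zero_iff hy, e]
  exact hβ

/-- Each step of the recursion defining `besselJZero` attains its infimum. -/
theorem isLeast_jz_succ {α : ℝ} (hα1 : 1 ≤ α) (hα2 : α < 2) {n : ℕ} (hn : 0 ≤ jz α n) :
    IsLeast {y : ℝ | jz α n < y ∧ besselJ (nu α) y = 0} (jz α (n + 1)) := by
  set S := {y : ℝ | jz α n < y ∧ besselJ (nu α) y = 0} with hS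
  have hne : S.Nonempty := by
    by_contra h
    refine infinite_zeros_besselJ hα1 hα2 ((finite_zeros_besselJ_le hα1 hα2 (jz α n)).subset ?_)
    intro y hy
    refine ⟨hy, not_lt.1 fun hlt => h ⟨y, hlt, hy.2⟩⟩
  obtain ⟨z, hz⟩ := hne
  have hfin : (S ∩ Iic z).Finite := (finite_zeros_besselJ_le hα1 hα2 z).subset
    fun y hy => ⟨⟨hn.trans_lt hy.1.1, hy.1.2⟩, hy.2⟩
  obtain ⟨m, hm, hmin⟩ := exists_min_image _ id hfin ⟨z, hz, mem_Iic.2 le_rfl⟩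
  have hleast : IsLeast S m := by
    refine ⟨hm.1, fun y hy => ?_⟩
    rcases le_total y z with h | h
    · exact hmin y ⟨hy, h⟩
    · exact (show m ≤ z from hm.2).trans h
  have : jz α (n + 1) = m := hleast.csInf_eq
  rwa [this]

theorem jz_nonneg {α : ℝ} (hα1 : 1 ≤ α) (hα2 : α < 2) (n : ℕ) : 0 ≤ jz α n := by
  induction n with
  | zero => exact le_rfl
  | succ n ih => exact ih.trans (isLeast_jz_succ hα1 hα2 ih).1.1.le

theorem strictMono_jz {α : ℝ} (hα1 : 1 ≤ α) (hα2 : α < 2) : StrictMono (jz α) :=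
  strictMono_nat_of_lt_succ fun n => (isLeast_jz_succ hα1 hα2 (jz_nonneg hα1 hα2 n)).1.1

theorem jz_pos {α : ℝ} (hα1 : 1 ≤ α) (hα2 : α < 2) {n : ℕ} (hn : 1 ≤ n) : 0 < jz α n :=
  (jz_nonneg hα1 hα2 0).trans_lt (strictMono_jz hα1 hα2 hn)

theorem besselJ_jz {α : ℝ} (hα1 : 1 ≤ α) (hα2 : α < 2)
    {n : ℕ} (hn : 1 ≤ n) : besselJ (nu α) (jz α n) = 0 := by
  obtain ⟨m, rfl⟩ := Nat.exists_eq_add_of_le' hn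
  exact (isLeast_jz_succ hα1 hα2 (jz_nonneg hα1 hα2 m)).1.2

theorem exists_jz_eq {α : ℝ} (hα1 : 1 ≤ α) (hα2 : α < 2)
    {y : ℝ} (hy : 0 < y) (h0 : besselJ (nu α) y = 0) :
    ∃ n : ℕ, 1 ≤ n ∧ y = jz α n := by
  by_contra! h
  have hlt : ∀ n, jz α n < y := by
    intro n
    induction n with
    | zero => exact hy
    | succ n ih =>
      exact lt_of_le_of_ne ((isLeast_jz_succ hα1 hα2 (jz_nonneg hα1 hα2 n)).2 ⟨ih, h0⟩)
        (h (n + 1) (by omega)).symm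
  have hinj : Function.Injective fun n => jz α (n + 1) :=
    (strictMono_jz hα1 hα2).injective.comp (add_left_injective 1)
  refine Set.infinite_range_of_injective hinj ((finite_zeros_besselJ_le hα1 hα2 y).subset ?_)
  rintro - ⟨n, rfl⟩
  exact ⟨⟨jz_pos hα1 hα2 (by omega), besselJ_jz hα1 hα2 (by omega)⟩, (hlt _).le⟩

/-! ### The normalized eigenfunctions -/

/-- The spectral parameter `j²/4` of the radial solution belonging to `j_{ν,n}`. -/
def radialParam (α : ℝ) (n : ℕ) : ℝ := jz α n ^ 2 / 4

/-- The factor by which the normalized profile differs from the radial solution. -/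
def profileCoef (α : ℝ) (n : ℕ) : ℝ :=
  √(2 * kappa α) / |deriv (besselJ (nu α)) (jz α n)| * (jz α n / 2) ^ nu α

theorem eigval_eq (α : ℝ) (n : ℕ) : eigval α n = radialParam α n * (2 - α) ^ 2 := by
  rw [eigval, radialParam, kappa]
  ring

theorem besselSeries_radialParam {α : ℝ} (hα1 : 1 ≤ α) (hα2 : α < 2) {n : ℕ} (hn : 1 ≤ n) :
    besselSeries (nu α) (radialParam α n) = 0 :=
  (besselJ_eq_zero_iff (jz_pos hα1 hα2 hn)).1 (besselJ_jz hα1 hα2 hn)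

theorem radialParam_injective {α : ℝ} (hα1 : 1 ≤ α) (hα2 : α < 2) {m n : ℕ} (hm : 1 ≤ m)
    (hn : 1 ≤ n) (h : radialParam α m = radialParam α n) : m = n :=
  (strictMono_jz hα1 hα2).injective
    (quarter_sq_injOn (jz_pos hα1 hα2 hm) (jz_pos hα1 hα2 hn) h)

theorem exists_radialParam_eq {α β : ℝ} (hα1 : 1 ≤ α) (hα2 : α < 2)
    (hβ : besselSeries (nu α) β = 0) : ∃ n : ℕ, 1 ≤ n ∧ β = radialParam α n := by
  have hβ0 := pos_of_besselSeries_eq_zero hα1 hα2 hβ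
  have e : (2 * √β) ^ 2 / 4 = β := by
    rw [mul_pow, Real.sq_sqrt hβ0.le]
    ring
  have hy : 0 < 2 * √β := by positivity
  obtain ⟨n, hn, h⟩ := exists_jz_eq hα1 hα2 hy
    (by rw [besselJ_eq_zero_iff hy, e]; exact hβ)
  exact ⟨n, hn, by rw [radialParam, ← h, e]⟩

theorem profile_eq {α t : ℝ} (hα1 : 1 ≤ α) (hα2 : α < 2) {n : ℕ} (hn : 1 ≤ n) (ht : 0 < t) :
    profile α n t = profileCoef α n * radial α (radialParam α n) t := by
  have hj := jz_pos hα1 hα2 hn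
  have htk : 0 < t ^ kappa α := Real.rpow_pos_of_pos ht _
  have e1 : (jz α n * t ^ kappa α) ^ 2 / 4 = radialParam α n * |t| ^ (2 - α) := by
    rw [mul_pow, ← Real.rpow_natCast (t ^ kappa α), ← Real.rpow_mul ht.le, abs_of_pos ht,
      radialParam, kappa]
    push_cast
    ring_nf
  have e2 : (jz α n * t ^ kappa α / 2) ^ nu α = (jz α n / 2) ^ nu α * t ^ ((α - 1) / 2) := by
    rw [mul_div_right_comm, Real.mul_rpow (by positivity) htk.le, ← Real.rpow_mul ht.le]
    congr 2
    rw [kappa, nu]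
    have : 2 - α ≠ 0 := by linarith
    field_simp
  have e3 : t ^ ((1 - α) / 2) * t ^ ((α - 1) / 2) = 1 := by
    rw [← Real.rpow_add ht, show (1 - α) / 2 + (α - 1) / 2 = 0 by ring, Real.rpow_zero]
  rw [profile, besselJ_eq (by positivity), e1, e2, profileCoef, radial]
  linear_combination (√(2 * kappa α) / |deriv (besselJ (nu α)) (jz α n)| * (jz α n / 2) ^ nu α *
    besselSeries (nu α) (radialParam α n * |t| ^ (2 - α))) * e3

theorem phiRight_eq {α : ℝ} (hα1 : 1 ≤ α) (hα2 : α < 2) {n : ℕ} (hn : 1 ≤ n) :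
    phiRight α n = twoSided α (radialParam α n) (profileCoef α n) 0 := by
  ext x
  rw [phiRight, twoSided]
  split_ifs with h1 h2
  · rw [profile_eq hα1 hα2 hn (abs_pos.2 h1.ne'), radial_abs]
  · rw [zero_mul]
  · rfl

theorem phiLeft_eq {α : ℝ} (hα1 : 1 ≤ α) (hα2 : α < 2) {n : ℕ} (hn : 1 ≤ n) :
    phiLeft α n = twoSided α (radialParam α n) 0 (profileCoef α n) := by
  ext x
  rw [phiLeft, twoSided]
  split_ifs with h1 h2 h2
  · exact absurd h1 h2.not_gt
  · rw [profile_eq hα1 hα2 hn (abs_pos.2 h1.ne), radial_abs]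
  · rw [zero_mul]
  · rfl

theorem profileCoef_sq_mul_integral {α : ℝ} (hα1 : 1 ≤ α) (hα2 : α < 2) {n : ℕ} (hn : 1 ≤ n) :
    profileCoef α n ^ 2 *
      ∫ x in (0 : ℝ)..1, radial α (radialParam α n) x * radial α (radialParam α n) x = 1 := by
  have hβ := besselSeries_radialParam hα1 hα2 hn
  have hj := jz_pos hα1 hα2 hn
  have hb := besselSeries_add_one_ne_zero hα1 hα2 hβ
  have hp : (jz α n / 2) ^ nu α ≠ 0 := (Real.rpow_pos_of_pos (by positivity) _).ne'
  have hκ : 0 ≤ 2 * kappa α := by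
    rw [kappa]
    linarith
  have h2 : 2 - α ≠ 0 := by linarith
  simp only [← sq]
  rw [integral_radial_sq hα1 hα2 (by rw [radialParam]; positivity) hβ, profileCoef,
    deriv_besselJ_of_zero (nu_nonneg hα1 hα2) hj hβ, ← radialParam, mul_pow, div_pow, sq_abs,
    Real.sq_sqrt hκ, kappa]
  rw [radialParam] at hb ⊢
  field_simp
  norm_num

theorem inner_twoSidedLp_radialParam {α : ℝ} (hα1 : 1 ≤ α) (hα2 : α < 2) {m n : ℕ} (hm : 1 ≤ m)
    (hn : 1 ≤ n) (a b c d : ℝ) :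
    inner ℝ (twoSidedLp α hα1 hα2 (radialParam α m) (profileCoef α m * a) (profileCoef α m * b))
      (twoSidedLp α hα1 hα2 (radialParam α n) (profileCoef α n * c) (profileCoef α n * d)) =
      if m = n then a * c + b * d else 0 := by
  rw [inner_twoSidedLp]
  split_ifs with h
  · subst h
    linear_combination (a * c + b * d) * profileCoef_sq_mul_integral hα1 hα2 hm
  · rw [integral_radial_mul_radial hα1 hα2 (fun h' => h (radialParam_injective hα1 hα2 hm hn h'))
      (besselSeries_radialParam hα1 hα2 hm) (besselSeries_radialParam hα1 hα2 hn), mul_zero]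

theorem profileCoef_ne_zero {α : ℝ} (hα1 : 1 ≤ α) (hα2 : α < 2) {n : ℕ} (hn : 1 ≤ n) :
    profileCoef α n ≠ 0 := by
  intro h
  have := profileCoef_sq_mul_integral hα1 hα2 hn
  rw [h] at this
  norm_num at this

theorem memLp_phiRight {α : ℝ} (hα1 : 1 ≤ α) (hα2 : α < 2) (n : ℕ+) :
    MemLp (phiRight α n) 2 vol := by
  rw [phiRight_eq hα1 hα2 n.pos]
  exact memLp_twoSided hα1 hα2 _ _ _

theorem memLp_phiLeft {α : ℝ} (hα1 : 1 ≤ α) (hα2 : α < 2) (n : ℕ+) :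
    MemLp (phiLeft α n) 2 vol := by
  rw [phiLeft_eq hα1 hα2 n.pos]
  exact memLp_twoSided hα1 hα2 _ _ _

theorem toLp_phiRight {α : ℝ} (hα1 : 1 ≤ α) (hα2 : α < 2) (n : ℕ+) :
    (memLp_phiRight hα1 hα2 n).toLp = twoSidedLp α hα1 hα2 (radialParam α n)
      (profileCoef α n * 1) (profileCoef α n * 0) := by
  rw [twoSidedLp]
  refine (MemLp.toLp_eq_toLp_iff _ _).2 (.of_eq ?_)
  rw [phiRight_eq hα1 hα2 n.pos, mul_one, mul_zero]

theorem toLp_phiLeft {α : ℝ} (hα1 : 1 ≤ α) (hα2 : α < 2) (n : ℕ+) :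
    (memLp_phiLeft hα1 hα2 n).toLp = twoSidedLp α hα1 hα2 (radialParam α n)
      (profileCoef α n * 0) (profileCoef α n * 1) := by
  rw [twoSidedLp]
  refine (MemLp.toLp_eq_toLp_iff _ _).2 (.of_eq ?_)
  rw [phiLeft_eq hα1 hα2 n.pos, mul_one, mul_zero]

/-- A general eigenfunction in terms of the two normalized ones. -/
theorem twoSidedLp_eq_phi {α : ℝ} (hα1 : 1 ≤ α) (hα2 : α < 2) (n : ℕ+) (a b : ℝ) :
    twoSidedLp α hα1 hα2 (radialParam α n) a b =
      (a / profileCoef α n) • (memLp_phiRight hα1 hα2 n).toLp +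
        (b / profileCoef α n) • (memLp_phiLeft hα1 hα2 n).toLp := by
  have h := profileCoef_ne_zero hα1 hα2 n.pos
  rw [toLp_phiRight hα1 hα2, toLp_phiLeft hα1 hα2, twoSidedLp_eq,
    twoSidedLp_eq hα1 hα2 _ (profileCoef α n * 1),
    twoSidedLp_eq hα1 hα2 _ (profileCoef α n * 0)]
  simp only [mul_one, mul_zero, zero_smul, zero_add, add_zero, smul_smul, div_mul_cancel₀ _ h]

theorem isEigenvalue_iff {α : ℝ} (hα1 : 1 ≤ α) (hα2 : α < 2) (lam : ℝ) :
    IsEigenvalue α lam ↔ ∃ n : ℕ, 1 ≤ n ∧ lam = eigval α n := by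
  constructor
  · rintro ⟨u, hu, hu0⟩
    obtain ⟨a, b, rfl, hab⟩ := exists_of_mem_eigenspace hα1 hα2 hu
    have hβ : besselSeries (nu α) (lam / (2 - α) ^ 2) = 0 := by
      by_contra h
      obtain ⟨rfl, rfl⟩ := hab h
      exact hu0 (twoSidedLp_zero hα1 hα2 _)
    obtain ⟨n, hn, h⟩ := exists_radialParam_eq hα1 hα2 hβ
    have h2 : (2 - α) ^ 2 ≠ 0 := pow_ne_zero _ (by linarith)
    exact ⟨n, hn, by rw [eigval_eq, ← h, div_mul_cancel₀ _ h2]⟩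
  · rintro ⟨n, hn, rfl⟩
    rw [eigval_eq]
    refine ⟨_, twoSidedLp_mem_eigenspace hα1 hα2 (besselSeries_radialParam hα1 hα2 hn)
      (profileCoef α n * 1) (profileCoef α n * 0), fun h => ?_⟩
    have := inner_twoSidedLp_radialParam hα1 hα2 hn hn 1 0 1 0
    rw [h, inner_zero_left] at this
    norm_num at this

theorem exists_orthonormalBasis_eigenspace {α : ℝ} (hα1 : 1 ≤ α) (hα2 : α < 2) (n : ℕ+) :
    ∃ b : OrthonormalBasis (Fin 2) ℝ (eigenspace α (eigval α n)),
      (b 0 : X) = (memLp_phiRight hα1 hα2 n).toLp ∧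
        (b 1 : X) = (memLp_phiLeft hα1 hα2 n).toLp := by
  have hmem (a b : ℝ) : twoSidedLp α hα1 hα2 (radialParam α n) a b ∈
      eigenspace α (eigval α n) := by
    rw [eigval_eq]
    exact twoSidedLp_mem_eigenspace hα1 hα2 (besselSeries_radialParam hα1 hα2 n.pos) a b
  set e : Fin 2 → eigenspace α (eigval α n) :=
    ![⟨_, (toLp_phiRight hα1 hα2 n) ▸ hmem _ _⟩, ⟨_, (toLp_phiLeft hα1 hα2 n) ▸ hmem _ _⟩] with he
  have h0 : (e 0 : X) = (memLp_phiRight hα1 hα2 n).toLp := rfl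
  have h1 : (e 1 : X) = (memLp_phiLeft hα1 hα2 n).toLp := rfl
  have hon : Orthonormal ℝ e := by
    rw [orthonormal_iff_ite]
    intro i j
    rw [Submodule.coe_inner]
    fin_cases i <;> fin_cases j <;>
      simp only [Fin.zero_eta, Fin.mk_one, h0, h1, toLp_phiRight hα1 hα2,
        toLp_phiLeft hα1 hα2, inner_twoSidedLp_radialParam hα1 hα2 n.pos n.pos] <;> simp
  have hspan : ⊤ ≤ Submodule.span ℝ (range e) := by
    rintro ⟨u, hu⟩ -
    obtain ⟨a, b, hab, -⟩ := exists_of_mem_eigenspace hα1 hα2 hu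
    have h2 : (2 - α) ^ 2 ≠ 0 := pow_ne_zero _ (by linarith)
    rw [eigval_eq, mul_div_cancel_right₀ _ h2, twoSidedLp_eq_phi, ← h0, ← h1] at hab
    have : (⟨u, hu⟩ : eigenspace α (eigval α n)) =
        (a / profileCoef α n) • e 0 + (b / profileCoef α n) • e 1 := Subtype.ext hab
    rw [this]
    exact add_mem (Submodule.smul_mem _ _ (Submodule.subset_span (mem_range_self 0)))
      (Submodule.smul_mem _ _ (Submodule.subset_span (mem_range_self 1)))
  refine ⟨OrthonormalBasis.mk hon hspan, ?_, ?_⟩ <;> rw [OrthonormalBasis.coe_mk]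
  exacts [h0, h1]

theorem orthonormal_phi {α : ℝ} (hα1 : 1 ≤ α) (hα2 : α < 2) :
    Orthonormal ℝ (Sum.elim (fun n : ℕ+ => (memLp_phiRight hα1 hα2 n).toLp)
      (fun n : ℕ+ => (memLp_phiLeft hα1 hα2 n).toLp) : ℕ+ ⊕ ℕ+ → X) := by
  rw [orthonormal_iff_ite]
  rintro (m | m) (n | n) <;>
    simp [toLp_phiRight hα1 hα2, toLp_phiLeft hα1 hα2,
      -mul_one, -mul_zero, inner_twoSidedLp_radialParam hα1 hα2 m.pos n.pos]

theorem span_phi_orthogonal {α : ℝ} (hα1 : 1 ≤ α) (hα2 : α < 2) :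
    (Submodule.span ℝ (range (Sum.elim (fun n : ℕ+ => (memLp_phiRight hα1 hα2 n).toLp)
      (fun n : ℕ+ => (memLp_phiLeft hα1 hα2 n).toLp) : ℕ+ ⊕ ℕ+ → X)))ᗮ = ⊥ := by
  rw [eq_bot_iff, ← eigenSpan_orthogonal hα1 hα2]
  refine Submodule.orthogonal_le (Submodule.span_le.2 ?_)
  have key {β : ℝ} (hβ : besselSeries (nu α) β = 0) (a b : ℝ) :
      twoSidedLp α hα1 hα2 β a b ∈ Submodule.span ℝ (range (Sum.elim
        (fun n : ℕ+ => (memLp_phiRight hα1 hα2 n).toLp)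
        (fun n : ℕ+ => (memLp_phiLeft hα1 hα2 n).toLp) : ℕ+ ⊕ ℕ+ → X)) := by
    obtain ⟨n, hn, rfl⟩ := exists_radialParam_eq hα1 hα2 hβ
    lift n to ℕ+ using hn
    rw [twoSidedLp_eq_phi]
    exact add_mem
      (Submodule.smul_mem _ _ (Submodule.subset_span (mem_range_self (Sum.inl n))))
      (Submodule.smul_mem _ _ (Submodule.subset_span (mem_range_self (Sum.inr n))))
  refine iUnion₂_subset fun β hβ => ?_
  rintro u (rfl | rfl)
  · exact key hβ 1 0
  · exact key hβ 0 1

end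

end StrongDegenerate

open StrongDegenerate

theorem mainTheorem5 (α : ℝ) (hα1 : 1 ≤ α) (hα2 : α < 2) :
    -- the `j_{ν_α,n}`, `n ≥ 1`, enumerate the positive zeros of the Bessel function increasingly
    (StrictMono (jz α) ∧
      {y : ℝ | 0 < y ∧ besselJ (nu α) y = 0} = {y : ℝ | ∃ n : ℕ, 1 ≤ n ∧ y = jz α n}) ∧
    -- the eigenvalues
    (∀ lam : ℝ, IsEigenvalue α lam ↔ ∃ n : ℕ, 1 ≤ n ∧ lam = eigval α n) ∧
    -- the eigenfunctions are square integrable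
    ∃ (hr : ∀ n : ℕ+, MemLp (phiRight α n) 2 vol) (hl : ∀ n : ℕ+, MemLp (phiLeft α n) 2 vol),
      -- each eigenspace is two-dimensional, with the stated orthonormal basis
      (∀ n : ℕ+, Module.finrank ℝ (eigenspace α (eigval α n)) = 2 ∧
        ∃ b : OrthonormalBasis (Fin 2) ℝ (eigenspace α (eigval α n)),
          (b 0 : X) = (hr n).toLp (phiRight α n) ∧ (b 1 : X) = (hl n).toLp (phiLeft α n)) ∧
      -- all of them together form an orthonormal basis of `L²(-1,1)`
      ∃ B : HilbertBasis (ℕ+ ⊕ ℕ+) ℝ X,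
        ⇑B = Sum.elim (fun n : ℕ+ => (hr n).toLp (phiRight α n))
          (fun n : ℕ+ => (hl n).toLp (phiLeft α n)) := by
  refine ⟨⟨strictMono_jz hα1 hα2, ?_⟩, isEigenvalue_iff hα1 hα2, memLp_phiRight hα1 hα2,
    memLp_phiLeft hα1 hα2, fun n => ?_, ?_⟩
  · ext y
    constructor
    · rintro ⟨hy, h0⟩
      exact exists_jz_eq hα1 hα2 hy h0
    · rintro ⟨n, hn, rfl⟩
      exact ⟨jz_pos hα1 hα2 hn, besselJ_jz hα1 hα2 hn⟩
  · obtain ⟨b, hb⟩ := exists_orthonormalBasis_eigenspace hα1 hα2 n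
    exact ⟨by simpa using Module.finrank_eq_card_basis b.toBasis, b, hb⟩
  · exact ⟨HilbertBasis.mkOfOrthogonalEqBot (orthonormal_phi hα1 hα2)
      (span_phi_orthogonal hα1 hα2), HilbertBasis.coe_mkOfOrthogonalEqBot _ _⟩
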